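/- **Setting.** A *stabilisation monoid* $\mathbf M=\langle M,\cdot,\le,\sharp\rangle$ is a finite monoid with unit $1$ and a partial order $\le$ compatible with the product, together with a map $\sharp$ from idempotents to idempotents such that, for all idempotents $e,f$ and all $a,b\in M$ with $ab$ and $ba$ idempotent: $e\le f$ implies $e^\sharp\le f^\sharp$; $(ab)^\sharp=a(ba)^\sharp b$; $e^\sharp\le e$; $(e^\sharp)^\sharp=e^\sharp$; and $1^\sharp=1$. For $n\in\mathbb N$, an *$n$-under-computation* for a non-empty word $a_1\cdots a_l\in M^+$ is an ordered tree with $l$ leaves, each node $x$ being labelled by a value $v(x)\in M$, such that for every node $x$ with children $y_1,\dots,y_k$ one of the following holds: $x$ is the $m$-th leaf and $v(x)\le a_m$; or $k=2$ and $v(x)\le v(y_1)\cdot v(y_2)$; or $2\le k\le n$, $v(y_1)=\dots=v(y_k)=e$ is idempotent and $v(x)\le e$; or $k>n$, $v(y_1)=\dots=v(y_k)=e$ is idempotent and $v(x)\le e^\sharp$. *$n$-over-computations* and *$n$-computations* are obtained by replacing "$v(x)\le$" by "$v(x)\ge$" and by "$v(x)=$", respectively. The value of the tree is the value of its root, and leaves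 do not count for its height. An $n$-(under- /over-)computation for an arbitrary word $u\in M^*$ is one for some non-empty word from which $u$ is obtained by deleting some occurrences of the letter $1$. For $f,g:E\to\mathbb N\cup\{\infty\}$ write $f\approx g$ if there is a non-decreasing $\alpha:\mathbb N\to\mathbb N$ with $\alpha(n)\ge n$ for all $n$ such that $f\le\alpha\circ g$ and $g\le\alpha\circ f$, where $\alpha(\infty)=\infty$. A *cost function* is an equivalence class of $\approx$. An *ideal* is a downward closed subset (possibly empty); $X{\downarrow}$ denotes the ideal generated by $X$. Let $h:A\to M$ be a map from an alphabet $A$, extended letterwise to words, and let $I\subseteq M$ be an ideal. The triple $\mathbf M,h,I$ *recognises* (the cost function of) $f:A^*\to\mathbb N\cup\{\infty\}$ if for every $p\ge 3|M|$ the function $f$ is $\approx$-equivalent to each of the four functions mapping $u\in A^*$ to: - $\inf\{n:$ there is an $n$-under-computation for $h(u)$ of height at most $p$ and value in $M\setminus I\}$, - $\inf\{n:$ there is an $n$-computation for $h(u)$ of height at most $p$ and value in $M\setminus I\}$, - $\sup\{n+1:$ there is an $n$-computation for $h(u)$ of height at most $p$ and value in $I\}$, - $\sup\{n+1:$ there is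 an $n$-over-computation for $h(u)$ of height at most $p$ and value in $I\}$. The *inf-projection* of $f$ along $z:A\to B$ (extended letterwise to words) is the function $f_{\inf,z}:B^*\to\mathbb N\cup\{\infty\}$, $f_{\inf,z}(v)=\inf\{f(u): u\in A^*,\ z(u)=v\}$. Let $\mathbf M_\downarrow$ be the set of all ideals of $\mathbf M$, ordered by inclusion, with product $P\cdot Q=\{pq:p\in P,\,q\in Q\}{\downarrow}$, unit $\{1\}{\downarrow}$, and, for an idempotent ideal $E$, $E^\sharp=(\langle E\rangle^{\sharp+}){\downarrow}$. Here $\langle E\rangle^{\sharp+}$ is the set of values of the expressions built from elements of $E$ by products and the operation $a\mapsto(a^\omega)^\sharp$ ($a^\omega$ being the idempotent power of $a$) in which the latter operation occurs at least once. **Theorem.** Recognisable cost functions are effectively closed under inf-projection. More precisely: 1. For every stabilisation monoid $\mathbf M$, $\mathbf M_\downarrow$ is a stabilisation monoid. If $\mathbf M,h,I$ recognises $f:A^*\to\mathbb N\cup\{\infty\}$ and $z:A\to B$ is any map, then $\mathbf M_\downarrow,H,K$ recognises $f_{\inf,z}$, where $H(b)=h(z^{-1}(b)){\downarrow}$ for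 $b\in B$ and $K=\{J\in\mathbf M_\downarrow: J\subseteq I\}$. 2. There is a computable function which, given any presentation of a stabilisation monoid $\mathbf M$, a map $h:A\to M$ and an ideal $I$ by finite tables, where $A=\{0,\dots,k-1\}$, and given $l\in\mathbb N$ and a map $z:A\to B=\{0,\dots,l-1\}$, outputs a presentation by finite tables of $\mathbf M_\downarrow,H,K$. -/

import Mathlib

universe u v w

/-! ## Cost functions -/

/-- Correction functions: non-decreasing maps `α : ℕ → ℕ` with `n ≤ α n`. -/
def IsCorrection (α : ℕ → ℕ) : Prop :=
  Monotone α ∧ ∀ n, n ≤ α n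

/-- `f ≼_α g`: pointwise `f x ≤ α (g x)`, where `α` is extended to `ℕ ∪ {∞}` by `α ∞ = ∞`. -/
def DominatedBy {E : Type u} (α : ℕ → ℕ) (f g : E → ℕ∞) : Prop :=
  ∀ x, f x ≤ ENat.map α (g x)

/-- `f ≈ g`: the two functions belong to the same cost function over `E`. -/
def CostEquiv {E : Type u} (f g : E → ℕ∞) : Prop :=
  ∃ α : ℕ → ℕ, IsCorrection α ∧ DominatedBy α f g ∧ DominatedBy α g f

/-- The inf-projection of `f` with respect to the letter-to-letter map `z`. -/
noncomputable def infProjection {A : Type v} {B : Type w} (z : A → B) (f : List A → ℕ∞) :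
    List B → ℕ∞ :=
  fun y => ⨅ (x : List A) (_ : x.map z = y), f x

/-! ## Stabilisation monoids -/

/-- The operations of a stabilisation monoid on a partially ordered set, without their laws.
Stabilisation is an operation on idempotents: the values of `sharp` at the other elements are
never looked at. -/
structure StabStructure (M : Type u) where
  mul : M → M → M
  one : M
  sharp : M → M

namespace StabStructure

/-- Idempotent elements. -/
def Idem {M : Type u} (S : StabStructure M) (e : M) : Prop :=
  S.mul e e = e

/-- The axioms of (finite) stabilisation monoids. -/
structure IsStabilisationMonoid {M : Type u} [PartialOrder M] (S : StabStructure M) : Prop where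
  finite : Finite M
  mul_assoc : ∀ a b c, S.mul (S.mul a b) c = S.mul a (S.mul b c)
  one_mul : ∀ a, S.mul S.one a = a
  mul_one : ∀ a, S.mul a S.one = a
  mul_le_mul : ∀ a a' b b', a ≤ a' → b ≤ b' → S.mul a b ≤ S.mul a' b'
  sharp_idem : ∀ e, S.Idem e → S.Idem (S.sharp e)
  sharp_mono : ∀ e f, S.Idem e → S.Idem f → e ≤ f → S.sharp e ≤ S.sharp f
  sharp_consistent : ∀ a b, S.Idem (S.mul a b) → S.Idem (S.mul b a) →
    S.sharp (S.mul a b) = S.mul (S.mul a (S.sharp (S.mul b a))) b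
  sharp_le : ∀ e, S.Idem e → S.sharp e ≤ e
  sharp_sharp : ∀ e, S.Idem e → S.sharp (S.sharp e) = S.sharp e
  sharp_one : S.sharp S.one = S.one

end StabStructure

/-! ## Computations -/

/-- Ordered unranked trees whose nodes are labelled by elements of `M`. -/
inductive CompTree (M : Type u) : Type u
  | leaf (x : M) : CompTree M
  | node (x : M) (k : ℕ) (children : Fin k → CompTree M) : CompTree M

namespace CompTree

/-- The value of a tree is the label of its root. -/
def value {M : Type u} : CompTree M → M
  | leaf x => x
  | node x _ _ => x

/-- The height of a tree; leaves do not count. -/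
def height {M : Type u} : CompTree M → ℕ
  | leaf _ => 0
  | node _ _ t => (Finset.univ.sup fun i => (t i).height) + 1

end CompTree

namespace StabStructure

/-- The condition on an inner node of value `x` whose children have the values `ys` (from left to
right), for the threshold `n`: it is a binary node, an idempotent node or a stabilisation node.
The relation `r` is `≤` for under-computations, `≥` for over-computations and `=` for
computations. -/
def NodeCondition {M : Type u} (S : StabStructure M) (r : M → M → Prop) (n : ℕ) (x : M)
    (ys : List M) : Prop :=
  (∃ y₁ y₂, ys = [y₁, y₂] ∧ r x (S.mul y₁ y₂)) ∨
  (2 ≤ ys.length ∧ ys.length ≤ n ∧ ∃ e, S.Idem e ∧ (∀ y ∈ ys, y = e) ∧ r x e) ∨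
  (n < ys.length ∧ ∃ e, S.Idem e ∧ (∀ y ∈ ys, y = e) ∧ r x (S.sharp e))

/-- `S.IsComputation r n T a`: the tree `T` is an `n`-computation (an `n`-under-computation,
an `n`-over-computation, depending on `r`) for the non-empty word `a`. -/
inductive IsComputation {M : Type u} (S : StabStructure M) (r : M → M → Prop) (n : ℕ) :
    CompTree M → List M → Prop
  | leaf (x a : M) (h : r x a) : IsComputation S r n (CompTree.leaf x) [a]
  | node (x : M) (k : ℕ) (t : Fin k → CompTree M) (a : Fin k → List M)
      (ht : ∀ i, IsComputation S r n (t i) (a i))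
      (hx : S.NodeCondition r n x (List.ofFn fun i => (t i).value)) :
      IsComputation S r n (CompTree.node x k t) (List.ofFn a).flatten

/-- `S.DeleteOnes a b`: the word `b` is obtained from `a` by deleting some occurrences of the
letter `1`. -/
inductive DeleteOnes {M : Type u} (S : StabStructure M) : List M → List M → Prop
  | nil : DeleteOnes S [] []
  | keep (x : M) (a b : List M) (h : DeleteOnes S a b) : DeleteOnes S (x :: a) (x :: b)
  | delete (a b : List M) (h : DeleteOnes S a b) : DeleteOnes S (S.one :: a) b

/-- There is an `n`-computation (under-, over-, depending on `r`) for the possibly empty word `b`,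
of height at most `p` and of value in `X`. As always over monoids, a computation for `b` is a
computation for some non-empty word from which `b` results by deleting some letters `1`. -/
def ExistsComputation {M : Type u} (S : StabStructure M) (r : M → M → Prop) (n p : ℕ)
    (b : List M) (X : Set M) : Prop :=
  ∃ (T : CompTree M) (a : List M), S.IsComputation r n T a ∧ S.DeleteOnes a b ∧
    T.height ≤ p ∧ T.value ∈ X

/-! ## Recognisability -/

/-- The infimum of the `n` with an `n`-under-computation of value outside `I` and height `≤ p`. -/
noncomputable def semMinusMinus {M : Type u} [PartialOrder M] {A : Type v} (S : StabStructure M)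
    (h : A → M) (I : LowerSet M) (p : ℕ) (x : List A) : ℕ∞ :=
  ⨅ (n : ℕ) (_ : S.ExistsComputation (fun y z => y ≤ z) n p (x.map h) (I : Set M)ᶜ), (n : ℕ∞)

/-- The infimum of the `n` with an `n`-computation of value outside `I` and height `≤ p`. -/
noncomputable def semMinus {M : Type u} [PartialOrder M] {A : Type v} (S : StabStructure M)
    (h : A → M) (I : LowerSet M) (p : ℕ) (x : List A) : ℕ∞ :=
  ⨅ (n : ℕ) (_ : S.ExistsComputation (fun y z => y = z) n p (x.map h) (I : Set M)ᶜ), (n : ℕ∞)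

/-- The supremum of the `n + 1` with an `n`-computation of value in `I` and height `≤ p`. -/
noncomputable def semPlus {M : Type u} [PartialOrder M] {A : Type v} (S : StabStructure M)
    (h : A → M) (I : LowerSet M) (p : ℕ) (x : List A) : ℕ∞ :=
  ⨆ (n : ℕ) (_ : S.ExistsComputation (fun y z => y = z) n p (x.map h) (I : Set M)),
    ((n + 1 : ℕ) : ℕ∞)

/-- The supremum of the `n + 1` with an `n`-over-computation of value in `I` and height `≤ p`. -/
noncomputable def semPlusPlus {M : Type u} [PartialOrder M] {A : Type v} (S : StabStructure M)
    (h : A → M) (I : LowerSet M) (p : ℕ) (x : List A) : ℕ∞ :=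
  ⨆ (n : ℕ) (_ : S.ExistsComputation (fun y z => y ≥ z) n p (x.map h) (I : Set M)),
    ((n + 1 : ℕ) : ℕ∞)

/-- `f` belongs to the cost function recognised by `M, h, I`. -/
def Recognises {M : Type u} [PartialOrder M] {A : Type v} (S : StabStructure M)
    (h : A → M) (I : LowerSet M) (f : List A → ℕ∞) : Prop :=
  ∀ p, 3 * Nat.card M ≤ p →
    CostEquiv f (S.semMinusMinus h I p) ∧ CostEquiv f (S.semMinus h I p) ∧
    CostEquiv f (S.semPlus h I p) ∧ CostEquiv f (S.semPlusPlus h I p)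

end StabStructure

/-! ## Stabilisation expressions and the monoid of ideals -/

/-- Stabilisation expressions over `A`: letters, products, and the exponent `ω♯`. -/
inductive SharpExpr (A : Type u) : Type u
  | letter (a : A) : SharpExpr A
  | mul (E F : SharpExpr A) : SharpExpr A
  | omegaSharp (E : SharpExpr A) : SharpExpr A

/-- An expression is strict if the exponent `ω♯` occurs in it. -/
def SharpExpr.IsStrict {A : Type u} : SharpExpr A → Prop
  | letter _ => False
  | mul E F => E.IsStrict ∨ F.IsStrict
  | omegaSharp _ => True

namespace StabStructure

/-- Powers. -/
def pow {M : Type u} (S : StabStructure M) (a : M) : ℕ → M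
  | 0 => S.one
  | n + 1 => S.mul (S.pow a n) a

/-- The value of an expression. In a finite monoid `M` the power of `a` with exponent `|M|!` is
the unique idempotent power of `a`; the exponent `ω♯` denotes its stabilisation. -/
noncomputable def exprValue {M : Type u} (S : StabStructure M) {A : Type v} (g : A → M) :
    SharpExpr A → M
  | .letter a => g a
  | .mul E F => S.mul (S.exprValue g E) (S.exprValue g F)
  | .omegaSharp E => S.sharp (S.pow (S.exprValue g E) (Nat.card M).factorial)

/-- The set of values of the strict expressions over a set `X` of elements. -/
def strictValues {M : Type u} (S : StabStructure M) (X : Set M) : Set M :=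
  {a | ∃ E : SharpExpr X, E.IsStrict ∧ S.exprValue (fun x : X => (x : M)) E = a}

/-- The structure on the set of ideals (downward closed subsets, the empty one included) of `M`,
ordered by inclusion. -/
noncomputable def ideals {M : Type u} [PartialOrder M] (S : StabStructure M) :
    StabStructure (LowerSet M) where
  mul P Q := lowerClosure (Set.image2 S.mul (P : Set M) (Q : Set M))
  one := LowerSet.Iic S.one
  sharp E := lowerClosure (S.strictValues (E : Set M))

end StabStructure

/-- The map sending a letter `b` to the ideal generated by `h (z⁻¹ b)`. -/
def idealMap {M : Type u} [PartialOrder M] {A : Type v} {B : Type w} (h : A → M) (z : A → B) :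
    B → LowerSet M :=
  fun b => lowerClosure (h '' (z ⁻¹' {b}))

/-! ## Effectivity -/

/-- Finite data describing a stabilisation monoid with elements numbered `0, …, size - 1`, a map
from the letters `0, …, k - 1` to it, and an ideal, all by their tables. -/
structure StabCode where
  size : ℕ
  one : ℕ
  mul : List (List ℕ)
  sharp : List ℕ
  le : List (List Bool)
  letters : List ℕ
  ideal : List Bool

namespace StabCode

/-- Codes as tuples. -/
def equivTuple : StabCode ≃
    ℕ × ℕ × List (List ℕ) × List ℕ × List (List Bool) × List ℕ × List Bool where
  toFun c := (c.size, c.one, c.mul, c.sharp, c.le, c.letters, c.ideal)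
  invFun t := ⟨t.1, t.2.1, t.2.2.1, t.2.2.2.1, t.2.2.2.2.1, t.2.2.2.2.2.1, t.2.2.2.2.2.2⟩
  left_inv _ := rfl
  right_inv _ := rfl

instance instPrimcodable : Primcodable StabCode :=
  Primcodable.ofEquiv _ equivTuple

open Classical in
/-- The code `c` describes the structure `S`, the map `h` and the ideal `I`, with respect to some
numbering of the elements. Entries of the stabilisation table at non-idempotent elements are
irrelevant. -/
def Presents {M : Type u} [PartialOrder M] {k : ℕ} (c : StabCode) (S : StabStructure M)
    (h : Fin k → M) (I : LowerSet M) : Prop :=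
  ∃ e : M ≃ Fin c.size,
    c.one = (e S.one : ℕ) ∧
    c.mul = List.ofFn (fun i => List.ofFn fun j => (e (S.mul (e.symm i) (e.symm j)) : ℕ)) ∧
    c.sharp.length = c.size ∧
    (∀ a, S.Idem a → c.sharp[(e a : ℕ)]? = some (e (S.sharp a) : ℕ)) ∧
    c.le = List.ofFn (fun i => List.ofFn fun j => decide (e.symm i ≤ e.symm j)) ∧
    c.letters = List.ofFn (fun i => (e (h i) : ℕ)) ∧
    c.ideal = List.ofFn (fun i => decide (e.symm i ∈ I))

end StabCode

/-! An ideal over a projected word records the values reachable over all its preimages at once. The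
laws of the monoid of ideals and both comparisons below rest on `mem_ideals_sharp`: for an
idempotent ideal `E`, the elements of `E♯` are those below some `a * e♯ * b` with `a, e, b ∈ E` and
`e` idempotent.

The four functions of the definition of recognition satisfy under-infimum ≤ exact infimum ≤ exact
supremum ≤ over-supremum. Only the middle inequality needs work: it asks that every non-empty word
have an exact `n`-computation of height at most `3|M|`, for every `n`. Hence it suffices to bound
the inf-projection by the under-infimum over the ideals, and the over-supremum over the ideals by
the inf-projection, up to corrections.

For the first bound, `exists_word_of_ideals` descends an under-computation of value `J` and turns
any `x ∈ J` into a word over `M` taken from the leaf ideals, with an under-computation of value `x`.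
An element of an idempotent ideal `E` lies below a product of as many elements of `E` as the node
has children; an element of `E♯` lies below `a * e♯ * b`, realised by `a`, many copies of `e`, and
`b`.

For the second bound, `exists_value_of_ideals` fixes a word over `M` taken from the leaf ideals and
climbs an over-computation of value `J`, producing an exact computation with value in `J`. At a
stabilisation node the values of the children form a long word over `E`. An exact `m`-computation of
bounded height for a word longer than `(m + 2)` to the height must use stabilisation, and this puts
its value in `E♯` (`mem_sharp_or_length_le`).

The height bound `3|M|` is a factorisation theorem in the style of Simon. A word over a two-sided
ideal is split from left to right at a maximal `J`-class `C`, into blocks with computations leaving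
`C` and a remainder inside `C`; each block costs height `3|C| - 1`, and induction applies to the
word of block values. Inside `C`, cuts are coloured by elements of `C` so that the words between
equally coloured cuts all have the same idempotent product (`exists_cut_colouring`). Either the runs
of such words are short or their idempotent is stable, so that the product is computed, or a long
run of an unstable idempotent drops out of `C` through its stabilisation.

Effectivity codes ideals as bit masks. The description of `E♯` by triples makes every table entry a
bounded search. -/

/-! ## Green's relations in finite monoids -/

section Green

variable {M : Type u} [Monoid M]

/-- Green's relation `R`. -/
def GreenR (x y : M) : Prop := (∃ c, x = y * c) ∧ ∃ c, y = x * c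

/-- Green's relation `L`. -/
def GreenL (x y : M) : Prop := (∃ c, x = c * y) ∧ ∃ c, y = c * x

/-- The preorder underlying Green's relation `J`. -/
def GreenJLe (x y : M) : Prop := ∃ a c, x = a * y * c

/-- Green's relation `J`. -/
def GreenJ (x y : M) : Prop := GreenJLe x y ∧ GreenJLe y x

namespace GreenJLe

theorem refl (x : M) : GreenJLe x x := ⟨1, 1, by simp⟩

theorem trans {x y z : M} : GreenJLe x y → GreenJLe y z → GreenJLe x z := by
  rintro ⟨a, c, rfl⟩ ⟨a', c', rfl⟩
  exact ⟨a * a', c' * c, by simp only [mul_assoc]⟩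

theorem mul_left (x y : M) : GreenJLe (y * x) x := ⟨y, 1, by simp⟩

theorem mul_right (x y : M) : GreenJLe (x * y) x := ⟨1, y, by simp⟩

end GreenJLe

namespace GreenJ

theorem refl (x : M) : GreenJ x x := ⟨.refl x, .refl x⟩

theorem symm {x y : M} (h : GreenJ x y) : GreenJ y x := ⟨h.2, h.1⟩

theorem trans {x y z : M} (h : GreenJ x y) (h' : GreenJ y z) : GreenJ x z :=
  ⟨h.1.trans h'.1, h'.2.trans h.2⟩

/-- A factor of an element of a `J`-class that lies below that class lies in it. -/
theorem of_le {x y j : M} (hx : GreenJ x j) (hxy : GreenJLe x y) (hy : GreenJLe y j) :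
    GreenJ y j := ⟨hy, hx.2.trans hxy⟩

end GreenJ

namespace GreenR

theorem refl (x : M) : GreenR x x := ⟨⟨1, by simp⟩, ⟨1, by simp⟩⟩

theorem symm {x y : M} (h : GreenR x y) : GreenR y x := ⟨h.2, h.1⟩

theorem trans {x y z : M} : GreenR x y → GreenR y z → GreenR x z := by
  rintro ⟨⟨a, ha⟩, ⟨b, hb⟩⟩ ⟨⟨c, hc⟩, ⟨d, hd⟩⟩
  exact ⟨⟨c * a, by rw [ha, hc, mul_assoc]⟩, ⟨b * d, by rw [hd, hb, mul_assoc]⟩⟩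

theorem mul_left {x y : M} (h : GreenR x y) (z : M) : GreenR (z * x) (z * y) := by
  obtain ⟨⟨a, ha⟩, ⟨b, hb⟩⟩ := h
  exact ⟨⟨a, by rw [mul_assoc, ← ha]⟩, ⟨b, by rw [mul_assoc, ← hb]⟩⟩

theorem greenJ {x y : M} (h : GreenR x y) : GreenJ x y := by
  obtain ⟨⟨a, ha⟩, ⟨b, hb⟩⟩ := h
  exact ⟨⟨1, a, by simpa using ha⟩, ⟨1, b, by simpa using hb⟩⟩

end GreenR

namespace GreenL

theorem symm {x y : M} (h : GreenL x y) : GreenL y x := ⟨h.2, h.1⟩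

theorem trans {x y z : M} : GreenL x y → GreenL y z → GreenL x z := by
  rintro ⟨⟨a, ha⟩, ⟨b, hb⟩⟩ ⟨⟨c, hc⟩, ⟨d, hd⟩⟩
  exact ⟨⟨a * c, by rw [ha, hc, mul_assoc]⟩, ⟨d * b, by rw [hd, hb, mul_assoc]⟩⟩

end GreenL

/-- The `R`-relation makes `s` a left identity for `t`, and the `L`-relation makes `t` a right
identity for `s`; so `s * t` equals both. -/
theorem IsIdempotentElem.eq_of_greenR_greenL {s t : M} (hs : s * s = s) (ht : t * t = t)
    (hR : GreenR s t) (hL : GreenL s t) : s = t := by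
  obtain ⟨c, hc⟩ := hR.2
  obtain ⟨d, hd⟩ := hL.1
  have h1 : s * t = t := by rw [hc, ← mul_assoc, hs]
  have h2 : s * t = s := by
    conv_lhs => rw [hd]
    rw [mul_assoc, ht, ← hd]
  exact h2.symm.trans h1

variable [Finite M]

/-- By pigeonhole two exponents `i < j ≤ |M|` give the same power. The period `j - i` divides
`|M|!`, which is at least `i`, so adding `|M|!` to the exponent `|M|!` changes nothing. -/
theorem pow_factorial_natCard_idem (a : M) :
    a ^ (Nat.card M).factorial * a ^ (Nat.card M).factorial = a ^ (Nat.card M).factorial := by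
  classical
  have := Fintype.ofFinite M
  set N := Nat.card M with hN
  obtain ⟨i, j, hij, h⟩ : ∃ i j : Fin (N + 1), i < j ∧ a ^ (i : ℕ) = a ^ (j : ℕ) := by
    obtain ⟨i, j, hne, h⟩ := Fintype.exists_ne_map_eq_of_card_lt
      (fun i : Fin (N + 1) => a ^ (i : ℕ)) (by simp [hN])
    rcases lt_or_gt_of_ne hne with h' | h'
    · exact ⟨i, j, h', h⟩
    · exact ⟨j, i, h', h.symm⟩
  have hij' : (i : ℕ) < j := hij
  have step : ∀ m, (i : ℕ) ≤ m → a ^ (m + (j - i)) = a ^ m := fun m hm => by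
    rw [show m + ((j : ℕ) - i) = (m - i) + j by omega, pow_add, ← h, ← pow_add]
    congr 1; omega
  have steps : ∀ k m, (i : ℕ) ≤ m → a ^ (m + k * (j - i)) = a ^ m := fun k m hm => by
    induction k with
    | zero => simp
    | succ k ih => rw [add_mul, one_mul, ← add_assoc, step _ (by omega), ih]
  obtain ⟨k, hk⟩ : ((j : ℕ) - i) ∣ N.factorial := Nat.dvd_factorial (by omega) (by omega)
  rw [← pow_add]
  conv_lhs => rw [hk, mul_comm]
  rw [mul_comm, ← hk]
  conv_lhs => rw [hk, mul_comm ((j : ℕ) - i)]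
  rw [mul_comm k, ← hk]
  have := steps k N.factorial ((by omega : (i : ℕ) ≤ N).trans (Nat.self_le_factorial N))
  rwa [mul_comm k, ← hk] at this

theorem exists_pow_succ_idem (a : M) : ∃ k, a ^ (k + 1) * a ^ (k + 1) = a ^ (k + 1) :=
  ⟨(Nat.card M).factorial - 1, by
    rw [Nat.sub_add_cancel (Nat.factorial_pos _)]; exact pow_factorial_natCard_idem a⟩

/-- Finite monoids are stable (left version). -/
theorem GreenJLe.greenL {x y : M} (h : GreenJLe x (y * x)) : GreenL x (y * x) := by
  refine ⟨?_, y, rfl⟩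
  obtain ⟨a, b, h⟩ := h
  have hk : ∀ k : ℕ, x = (a * y) ^ k * x * b ^ k := fun k => by
    induction k with
    | zero => simp
    | succ k ih =>
      rw [pow_succ, pow_succ']
      calc x = _ := ih
        _ = (a * y) ^ k * (a * (y * x) * b) * b ^ k := by rw [← h]
        _ = _ := by simp only [mul_assoc]
  -- An idempotent power `e` of `a * y` satisfies `x = e * x * c`, hence `e * x = x`: the multiplier
  -- on the right disappears.
  obtain ⟨k, he⟩ := exists_pow_succ_idem (a * y)
  have hx : x = (a * y) ^ (k + 1) * x := by
    have := hk (k + 1)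
    generalize (a * y) ^ (k + 1) = e at *
    generalize b ^ (k + 1) = c at *
    calc x = e * x * c := this
      _ = e * e * x * c := by rw [he]
      _ = e * (e * x * c) := by simp only [mul_assoc]
      _ = e * x := by rw [← this]
  exact ⟨(a * y) ^ k * a, by rw [pow_succ] at hx; rw [← mul_assoc, mul_assoc _ a y]; exact hx⟩

/-- Finite monoids are stable (right version). -/
theorem GreenJLe.greenR {x y : M} (h : GreenJLe x (x * y)) : GreenR x (x * y) := by
  refine ⟨?_, y, rfl⟩
  obtain ⟨a, b, h⟩ := h
  have hk : ∀ k : ℕ, x = a ^ k * x * (y * b) ^ k := fun k => by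
    induction k with
    | zero => simp
    | succ k ih =>
      rw [pow_succ, pow_succ']
      calc x = _ := ih
        _ = a ^ k * (a * (x * y) * b) * (y * b) ^ k := by rw [← h]
        _ = _ := by simp only [mul_assoc]
  obtain ⟨k, he⟩ := exists_pow_succ_idem (y * b)
  have hx : x = x * (y * b) ^ (k + 1) := by
    have := hk (k + 1)
    generalize (y * b) ^ (k + 1) = e at *
    generalize a ^ (k + 1) = c at *
    calc x = c * x * e := this
      _ = c * x * (e * e) := by rw [he]
      _ = c * x * e * e := by simp only [mul_assoc]
      _ = x * e := by rw [← this]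
  exact ⟨b * (y * b) ^ k, by rw [pow_succ'] at hx; simpa only [mul_assoc] using hx⟩

theorem GreenJ.greenL_mul {x y j : M} (hx : GreenJ x j) (h : GreenJ (y * x) j) :
    GreenL x (y * x) := GreenJLe.greenL (hx.1.trans h.2)

theorem GreenJ.greenR_mul {x y j : M} (hx : GreenJ x j) (h : GreenJ (x * y) j) :
    GreenR x (x * y) := GreenJLe.greenR (hx.1.trans h.2)

/-- Equivalent elements of a `J`-class are joined by a left and a right multiplication. -/
theorem GreenJ.exists_greenL_greenR {r b : M} (h : GreenJ r b) :
    ∃ β, GreenL b (β * b) ∧ GreenR (β * b) r := by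
  obtain ⟨β, α, hr⟩ := h.1
  have hβ : GreenJ (β * b) b :=
    GreenJ.of_le h (hr ▸ GreenJLe.mul_right _ _) (GreenJLe.mul_left _ _)
  exact ⟨β, (GreenJ.refl b).greenL_mul hβ, hr ▸ hβ.greenR_mul (hr ▸ h)⟩

/-- A colouring, by elements of the `J`-class of `b`, of the cuts of words whose letters and
product lie in this class. The colour of a cut depends on the product `P` of what precedes it and
on the next letter `a`. The word between two cuts of the same colour has an idempotent product,
which is determined by the colour. -/
theorem exists_cut_colouring (b : M) : ∃ (κ : M → M → M) (ε : M → M),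
    (∀ P a, GreenR P b → GreenJ a b → GreenJ (κ P a) b) ∧
    ∀ P a s a', GreenR P b → GreenJ a b → GreenJ a' b → GreenJ (P * (a * s)) b →
      κ P a = κ (P * (a * s)) a' →
      a * s = ε (κ P a) ∧ a * s * (a * s) = a * s ∧ GreenJ (a * s) b := by
  classical
  let st : Setoid M := ⟨GreenR, GreenR.refl, GreenR.symm, GreenR.trans⟩
  let rep : M → M := fun a => (Quotient.mk st a).out
  have hrep : ∀ a, GreenR (rep a) a := fun a => Quotient.exact (Quotient.out_eq (Quotient.mk st a))
  have hrep' : ∀ a a', GreenR a a' → rep a = rep a' := fun a a' h => by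
    simp only [rep]; rw [Quotient.sound (s := st) h]
  have hβ : ∀ r : M, ∃ β, GreenJ r b → GreenL b (β * b) ∧ GreenR (β * b) r := fun r => by
    by_cases h : GreenJ r b
    · obtain ⟨β, hβ⟩ := h.exists_greenL_greenR
      exact ⟨β, fun _ => hβ⟩
    · exact ⟨1, fun h' => absurd h' h⟩
  choose β hβ using hβ
  -- By Green's lemma, left multiplication by `β r` maps the `R`-class of `b` injectively into that
  -- of `r`. The colour therefore reveals the `R`-class of `a`, and then `P` itself, while staying
  -- inside the `J`-class.
  let κ : M → M → M := fun P a => β (rep a) * P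
  have hκR : ∀ P a, GreenR P b → GreenJ a b → GreenR (κ P a) a := fun P a hP ha =>
    ((hP.mul_left _).trans (hβ (rep a) ((hrep a).greenJ.trans ha)).2).trans (hrep a)
  have hκ : ∀ P a P' a', GreenR P b → GreenJ a b → GreenR P' b → GreenJ a' b →
      κ P a = κ P' a' → P = P' ∧ GreenR a a' := by
    intro P a P' a' hP ha hP' ha' h
    have hR : GreenR a a' := ((hκR P a hP ha).symm.trans (h ▸ GreenR.refl _)).trans
      (hκR P' a' hP' ha')
    refine ⟨?_, hR⟩
    simp only [κ] at h
    rw [hrep' _ _ hR] at h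
    obtain ⟨d, hd⟩ := (hβ (rep a') ((hrep a').greenJ.trans ha')).1.1
    obtain ⟨x, hx⟩ := hP.1
    obtain ⟨x', hx'⟩ := hP'.1
    calc P = d * (β (rep a') * P) := by rw [hx]; conv_lhs => rw [hd]
                                        simp only [mul_assoc]
      _ = d * (β (rep a') * P') := by rw [h]
      _ = P' := by rw [hx']; conv_rhs => rw [hd]
                   simp only [mul_assoc]
  -- A colour fixes an `L`-class (that of `P`) and an `R`-class (that of `a`); their intersection
  -- contains at most one idempotent.
  let good : M → M → Prop := fun c t => t * t = t ∧ ∃ P a, GreenR P b ∧ GreenJ a b ∧ κ P a = c ∧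
    GreenL t P ∧ GreenR t a
  have huniq : ∀ c t t', good c t → good c t' → t = t' := by
    rintro c t t' ⟨ht, P, a, hP, ha, hc, hL, hR⟩ ⟨ht', P', a', hP', ha', hc', hL', hR'⟩
    obtain ⟨rfl, haa⟩ := hκ P a P' a' hP ha hP' ha' (hc.trans hc'.symm)
    exact IsIdempotentElem.eq_of_greenR_greenL ht ht' ((hR.trans haa).trans hR'.symm)
      (hL.trans hL'.symm)
  refine ⟨κ, fun c => if h : ∃ t, good c t then h.choose else 1, ?_, ?_⟩
  · exact fun P a hP ha => (hκR P a hP ha).greenJ.trans ha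
  · intro P a s a' hP ha ha' hPt hc
    have hP' : GreenR (P * (a * s)) b := (hP.greenJ.greenR_mul hPt).symm.trans hP
    obtain ⟨hPP, -⟩ := hκ _ _ _ _ hP ha hP' ha' hc
    have htJ : GreenJ (a * s) b :=
      GreenJ.of_le hPt (GreenJLe.mul_left _ _) ((GreenJLe.mul_right _ _).trans ha.1)
    -- Equal colours force `P * (a * s) = P`, so stability puts `a * s` in the `L`-class of `P`;
    -- writing `a * s = d * P` then gives idempotency.
    have hL : GreenL (a * s) P := by
      have := htJ.greenL_mul hPt
      rwa [← hPP] at this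
    have hidem : a * s * (a * s) = a * s := by
      obtain ⟨d, hd⟩ := hL.1
      calc a * s * (a * s) = d * P * (a * s) := by rw [← hd]
        _ = d * (P * (a * s)) := mul_assoc _ _ _
        _ = a * s := by rw [← hPP, ← hd]
    have hg : good (κ P a) (a * s) := ⟨hidem, P, a, hP, ha, rfl, hL, (ha.greenR_mul htJ).symm⟩
    have hex : ∃ t, good (κ P a) t := ⟨_, hg⟩
    refine ⟨?_, hidem, htJ⟩
    simp only [dif_pos hex]
    exact huniq _ _ _ hg hex.choose_spec

/-- If `a * a'` stays in the `J`-class of `a` and `a'`, some element `g` in the `R`-class of `a`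
has `g * a` in this class. -/
theorem GreenJ.exists_greenR_mul {a a' : M} (ha' : GreenJ a' a) (h : GreenJ (a * a') a) :
    ∃ g, GreenR g a ∧ GreenJ (g * a) a := by
  obtain ⟨γ, δ, hγ⟩ := ha'.2
  have hy : GreenJ (a' * δ) a := by
    refine ⟨(GreenJLe.mul_right _ _).trans ha'.1, ⟨γ, 1, ?_⟩⟩
    rw [mul_one, ← mul_assoc]; exact hγ
  have hL : GreenL (a' * δ) a := by
    have := hy.greenL_mul (y := γ) (by rw [← mul_assoc, ← hγ]; exact GreenJ.refl a)
    rwa [← mul_assoc, ← hγ] at this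
  have hL2 : GreenL a' (a * a') := ha'.greenL_mul h
  have h3 : GreenJ (a * a' * δ) a := by
    obtain ⟨d, hd⟩ := hL2.1
    refine ⟨⟨1, a' * δ, by simp [mul_assoc]⟩, hy.2.trans ⟨d, 1, ?_⟩⟩
    conv_lhs => rw [hd]
    simp only [mul_assoc, mul_one]
  obtain ⟨η, hη⟩ := hL.1
  have h4 : GreenJ (a * η * a) a := by rwa [mul_assoc, ← hη, ← mul_assoc]
  exact ⟨a * η, ((GreenJ.refl a).greenR_mul
    (GreenJ.of_le h4 (GreenJLe.mul_right _ _) (GreenJLe.mul_right _ _))).symm, h4⟩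

end Green

/-! ## Computations of bounded height -/

namespace StabStructure

variable {M : Type u} {S : StabStructure M} {r : M → M → Prop} {n p q : ℕ} {x : M}

/-- There is an `n`-computation for the word `a` of height at most `p` and value `x`. -/
def HasComp (S : StabStructure M) (r : M → M → Prop) (n p : ℕ) (x : M) (a : List M) : Prop :=
  ∃ T, S.IsComputation r n T a ∧ T.height ≤ p ∧ T.value = x

theorem existsComputation_iff {b : List M} {X : Set M} :
    S.ExistsComputation r n p b X ↔ ∃ x ∈ X, ∃ a, S.HasComp r n p x a ∧ S.DeleteOnes a b := by
  constructor
  · rintro ⟨T, a, hT, ha, hp, hX⟩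
    exact ⟨_, hX, a, ⟨T, hT, hp, rfl⟩, ha⟩
  · rintro ⟨x, hX, a, ⟨T, hT, hp, rfl⟩, ha⟩
    exact ⟨T, a, hT, ha, hp, hX⟩

theorem NodeCondition.imp {r' : M → M → Prop} (h : ∀ x y, r x y → r' x y) {ys : List M}
    (hx : S.NodeCondition r n x ys) : S.NodeCondition r' n x ys := by
  rcases hx with ⟨y₁, y₂, hy, hr⟩ | ⟨h1, h2, e, he, hy, hr⟩ | ⟨h1, e, he, hy, hr⟩
  · exact .inl ⟨y₁, y₂, hy, h _ _ hr⟩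
  · exact .inr (.inl ⟨h1, h2, e, he, hy, h _ _ hr⟩)
  · exact .inr (.inr ⟨h1, e, he, hy, h _ _ hr⟩)

theorem NodeCondition.rel [IsTrans M r] {ys : List M} {y : M} (hy : r y x)
    (hx : S.NodeCondition r n x ys) : S.NodeCondition r n y ys := by
  rcases hx with ⟨y₁, y₂, hys, hr⟩ | ⟨h1, h2, e, he, hys, hr⟩ | ⟨h1, e, he, hys, hr⟩
  · exact .inl ⟨y₁, y₂, hys, _root_.trans hy hr⟩
  · exact .inr (.inl ⟨h1, h2, e, he, hys, _root_.trans hy hr⟩)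
  · exact .inr (.inr ⟨h1, e, he, hys, _root_.trans hy hr⟩)

theorem NodeCondition.ne_nil {ys : List M} (hx : S.NodeCondition r n x ys) : ys ≠ [] := by
  rintro rfl
  rcases hx with ⟨y₁, y₂, hys, hr⟩ | ⟨h1, h2, e, he, hys, hr⟩ | ⟨h1, e, he, hys, hr⟩
  · simp at hys
  · simp at h1
  · simp at h1

namespace HasComp

theorem leaf {a : M} (h : r x a) : S.HasComp r n p x [a] :=
  ⟨.leaf x, .leaf x a h, Nat.zero_le _, rfl⟩

theorem mono {a : List M} (h : S.HasComp r n p x a) (hpq : p ≤ q) : S.HasComp r n q x a :=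
  let ⟨T, h1, h2, h3⟩ := h
  ⟨T, h1, h2.trans hpq, h3⟩

theorem node {ys : List M} {ws : List (List M)} (h : List.Forall₂ (S.HasComp r n p) ys ws)
    (hx : S.NodeCondition r n x ys) : S.HasComp r n (p + 1) x ws.flatten := by
  rw [List.forall₂_iff_get] at h
  obtain ⟨hl, h⟩ := h
  have h' : ∀ i : Fin ws.length, S.HasComp r n p (ys.get (i.cast hl.symm)) (ws.get i) :=
    fun i => h i (by rw [hl]; exact i.2) i.2
  choose T hT hp hv using h'
  have hys : List.ofFn (fun i => (T i).value) = ys := by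
    simp only [hv]
    apply List.ext_get (by simp [hl])
    intro i h1 h2
    simp
  have hws : List.ofFn (fun i => ws.get i) = ws := List.ofFn_get ws
  refine ⟨.node x ws.length T, ?_, ?_, rfl⟩
  · have := IsComputation.node (S := S) (r := r) (n := n) x ws.length T (fun i => ws.get i) hT
      (by rwa [hys])
    rwa [hws] at this
  · simp only [CompTree.height, add_le_add_iff_right, Finset.sup_le_iff]
    exact fun i _ => hp i

theorem binary {y₁ y₂ : M} {a₁ a₂ : List M} (h₁ : S.HasComp r n p y₁ a₁)
    (h₂ : S.HasComp r n p y₂ a₂) (hx : r x (S.mul y₁ y₂)) :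
    S.HasComp r n (p + 1) x (a₁ ++ a₂) := by
  have := node (ws := [a₁, a₂]) (.cons h₁ (.cons h₂ .nil)) (.inl ⟨y₁, y₂, rfl, hx⟩)
  simpa using this

/-- This principle replaces structural recursion on trees: a computation is seen only through its
height bound, value and word. -/
theorem induction {Q : ℕ → M → List M → Prop}
    (leaf : ∀ p x a, r x a → Q p x [a])
    (node : ∀ p x ys ws, List.Forall₂ (fun y w => S.HasComp r n p y w ∧ Q p y w) ys ws →
      S.NodeCondition r n x ys → Q (p + 1) x ws.flatten) :
    ∀ {p x a}, S.HasComp r n p x a → Q p x a := by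
  intro p
  induction p with
  | zero =>
    rintro x a ⟨T, hT, hp, rfl⟩
    cases hT with
    | leaf x a h => exact leaf _ _ _ h
    | node x k t a ht hx => simp [CompTree.height] at hp
  | succ p ih =>
    rintro x a ⟨T, hT, hp, rfl⟩
    cases hT with
    | leaf x a h => exact leaf _ _ _ h
    | node x k t a ht hx =>
      refine node p x _ _ ?_ hx
      rw [List.forall₂_iff_get]
      refine ⟨by simp, fun i h1 h2 => ?_⟩
      have hi : S.HasComp r n p (t ⟨i, by simpa using h1⟩).value (a ⟨i, by simpa using h1⟩) := by
        refine ⟨_, ht _, ?_, rfl⟩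
        simp only [CompTree.height, add_le_add_iff_right, Finset.sup_le_iff] at hp
        exact hp _ (Finset.mem_univ _)
      simpa using ⟨hi, ih hi⟩

theorem imp {r' : M → M → Prop} (h : ∀ x y, r x y → r' x y) {a : List M}
    (hc : S.HasComp r n p x a) : S.HasComp r' n p x a := by
  refine HasComp.induction (Q := fun p x a => S.HasComp r' n p x a) ?_ ?_ hc
  · exact fun p x a ha => leaf (h _ _ ha)
  · exact fun p x ys ws hw hx => node (hw.imp fun _ _ h => h.2) (hx.imp h)

theorem ne_nil {a : List M} (hc : S.HasComp r n p x a) : a ≠ [] := by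
  refine HasComp.induction (Q := fun p x a => a ≠ []) ?_ ?_ hc
  · simp
  · intro p x ys ws hw hx
    cases hw with
    | nil => exact absurd rfl hx.ne_nil
    | cons h _ => simp [h.2]

theorem rel [IsTrans M r] {a : List M} {y : M} (hc : S.HasComp r n p x a) (hy : r y x) :
    S.HasComp r n p y a := by
  refine HasComp.induction (Q := fun p x a => r y x → S.HasComp r n p y a) ?_ ?_ hc hy
  · exact fun p x a ha hy => leaf (_root_.trans hy ha)
  · exact fun p x ys ws hw hx hy => node (hw.imp fun _ _ h => h.1) (hx.rel hy)

end HasComp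

theorem _root_.List.Forall₂.exists_flatten {α : Type u} {β : Type v} {R : α → β → Prop} :
    ∀ {ws : List (List α)} {b : List β}, List.Forall₂ R ws.flatten b →
      ∃ bs : List (List β), b = bs.flatten ∧ List.Forall₂ (List.Forall₂ R) ws bs
  | [], b, h => by
    have : b = [] := by simpa using h
    exact ⟨[], by simp [this], .nil⟩
  | w :: ws, b, h => by
    rw [List.flatten_cons] at h
    have h1 := (List.forall₂_take_append _ _ _ h.flip).flip
    have h2 := (List.forall₂_drop_append _ _ _ h.flip).flip
    obtain ⟨bs, hbs, hf⟩ := List.Forall₂.exists_flatten h2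
    exact ⟨b.take w.length :: bs, by rw [List.flatten_cons, ← hbs, List.take_append_drop],
      .cons h1 hf⟩

/-- Computations for the letters of a word may be substituted in a computation for it. -/
theorem HasComp.subst [IsTrans M r] {b : List M} (h : S.HasComp r n p x b) :
    ∀ {ws : List (List M)}, List.Forall₂ (S.HasComp r n q) b ws →
      S.HasComp r n (p + q) x ws.flatten := by
  refine HasComp.induction (Q := fun p x b => ∀ {ws : List (List M)},
    List.Forall₂ (S.HasComp r n q) b ws → S.HasComp r n (p + q) x ws.flatten) ?_ ?_ h
  · intro p x a ha ws hws
    cases hws with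
    | cons h h' =>
      cases h'
      simpa using (h.rel ha).mono (Nat.le_add_left _ _)
  · intro p x ys bs hb hx ws hws
    obtain ⟨wss, rfl, hw⟩ := hws.exists_flatten
    rw [show p + 1 + q = p + q + 1 by omega]
    rw [List.flatten_flatten]
    refine HasComp.node (ys := ys) ?_ hx
    rw [List.forall₂_iff_get] at hb hw ⊢
    refine ⟨by simp [hb.1, hw.1], fun i h1 h2 => ?_⟩
    have h3 : i < bs.length := hb.1 ▸ h1
    have h4 : i < wss.length := hw.1 ▸ h3
    simpa using (hb.2 i h1 h3).2 (hw.2 i h3 h4)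

end StabStructure

/-! ## Existence of computations of height at most `3|M|` -/

namespace StabStructure

variable {M : Type u} [Monoid M]

/-- The part of the laws of stabilisation monoids that does not involve the order. -/
structure SharpLaws (S : StabStructure M) : Prop where
  mul_eq : ∀ a b, S.mul a b = a * b
  idem : ∀ e, e * e = e → S.sharp e * S.sharp e = S.sharp e
  mul_sharp : ∀ e, e * e = e → e * S.sharp e = S.sharp e
  sharp_mul : ∀ e, e * e = e → S.sharp e * e = S.sharp e

/-- There is an `n`-computation of height at most `p` and value `x` for the word `a`. -/
abbrev ExactComp (S : StabStructure M) (n p : ℕ) (x : M) (a : List M) : Prop :=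
  S.HasComp (fun y z => y = z) n p x a

variable {S : StabStructure M} {n : ℕ}

theorem SharpLaws.binary (hS : S.SharpLaws) {p : ℕ} {x y : M} {a b : List M}
    (hx : S.ExactComp n p x a) (hy : S.ExactComp n p y b) :
    S.ExactComp n (p + 1) (x * y) (a ++ b) :=
  hx.binary hy (hS.mul_eq x y).symm

/-- An idempotent whose stabilisation lies in its `J`-class is stable. -/
theorem SharpLaws.sharp_eq [Finite M] (hS : S.SharpLaws) {e b : M} (he : e * e = e)
    (heb : GreenJ e b) (h : GreenJ (S.sharp e) b) : S.sharp e = e := by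
  have h1 := heb.greenR_mul (y := S.sharp e) (by rwa [hS.mul_sharp e he])
  rw [hS.mul_sharp e he] at h1
  obtain ⟨m, hm⟩ := h1.1
  calc S.sharp e = S.sharp e * e := (hS.sharp_mul e he).symm
    _ = S.sharp e * (S.sharp e * m) := by rw [← hm]
    _ = e := by rw [← mul_assoc, hS.idem e he, ← hm]

/-- In the `J`-order `e♯` lies between `y * e♯` and `e`, so it would be forced into the class
together with them. A stabilisation that has left the class cannot be brought back by a prefix. -/
theorem SharpLaws.not_greenJ_mul_sharp (hS : S.SharpLaws) {e b : M} (he : e * e = e)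
    (heb : GreenJ e b) (h : ¬ GreenJ (S.sharp e) b) (y : M) : ¬ GreenJ (y * S.sharp e) b :=
  fun h' => h (h'.of_le (GreenJLe.mul_left _ _)
    (((hS.mul_sharp e he) ▸ GreenJLe.mul_right e (S.sharp e)).trans heb.1))

theorem _root_.List.prod_flatten_of_idem {e : M} (he : e * e = e) {ws : List (List M)}
    (hne : ws ≠ []) (h : ∀ x ∈ ws, x.prod = e) : ws.flatten.prod = e := by
  induction ws with
  | nil => exact absurd rfl hne
  | cons x ws ih =>
    rw [List.flatten_cons, List.prod_append, h x (by simp)]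
    rcases eq_or_ne ws [] with rfl | hws
    · simp
    · rw [ih hws fun y hy => h y (by simp [hy]), he]

/-- The node above a run of words of the same idempotent value. -/
theorem SharpLaws.run (hS : S.SharpLaws) {p : ℕ} {e : M} (he : e * e = e) {ws : List (List M)}
    (hne : ws ≠ []) (h : ∀ x ∈ ws, S.ExactComp n p e x) (hn : ws.length ≤ n ∨ S.sharp e = e) :
    S.ExactComp n (p + 1) e ws.flatten := by
  have hf : List.Forall₂ (S.ExactComp n p) (List.replicate ws.length e) ws := by
    rw [List.forall₂_iff_get]
    exact ⟨by simp, fun i h1 h2 => by simpa using h _ (List.getElem_mem h2)⟩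
  have hidem : S.Idem e := (hS.mul_eq e e).trans he
  rcases Nat.lt_or_ge ws.length 2 with hl | hl
  · obtain ⟨x, rfl⟩ : ∃ x, ws = [x] := by
      match ws, hne, hl with
      | [x], _, _ => exact ⟨x, rfl⟩
    simpa using (h x (by simp)).mono (Nat.le_succ p)
  · refine HasComp.node hf ?_
    by_cases hln : ws.length ≤ n
    · exact .inr (.inl ⟨by simpa, by simpa, e, hidem, by simp, rfl⟩)
    · exact .inr (.inr ⟨by simpa using hln, e, hidem, by simp,
        (hn.resolve_left hln).symm⟩)

theorem SharpLaws.stabRun (hS : S.SharpLaws) {p : ℕ} {e : M} (he : e * e = e)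
    {ws : List (List M)} (h : ∀ x ∈ ws, S.ExactComp n p e x) (hn : n < ws.length) :
    S.ExactComp n (p + 1) (S.sharp e) ws.flatten := by
  have hf : List.Forall₂ (S.ExactComp n p) (List.replicate ws.length e) ws := by
    rw [List.forall₂_iff_get]
    exact ⟨by simp, fun i h1 h2 => by simpa using h _ (List.getElem_mem h2)⟩
  exact HasComp.node hf (.inr (.inr ⟨by simpa using hn, e, (hS.mul_eq e e).trans he,
    by simp, rfl⟩))

/-- One level builds the run and one joins it to the tail. With no blocks there is no run, and
idempotency of `e` is not available, hence the guard on `he`. -/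
theorem SharpLaws.absorb (hS : S.SharpLaws) {p : ℕ} {e v : M} {ws : List (List M)} {w : List M}
    (he : ws ≠ [] → e * e = e) (h : ∀ x ∈ ws, S.ExactComp n p e x ∧ x.prod = e)
    (hn : ws.length ≤ n ∨ S.sharp e = e) (hw : S.ExactComp n (p + 1) v w) :
    S.ExactComp n (p + 2) (ws.flatten.prod * v) (ws.flatten ++ w) := by
  rcases eq_or_ne ws [] with rfl | hne
  · simpa using hw.mono (Nat.le_succ _)
  · rw [List.prod_flatten_of_idem (he hne) hne fun x hx => (h x hx).2]
    exact hS.binary (hS.run (he hne) hne (fun x hx => (h x hx).1) hn) hw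

/-! ### Coloured words -/

/-- The colours of the letters of a word, read after a word of product `P`: the colour of a letter
is that of the cut before it. -/
def cutColours (κ : M → M → M) : M → List M → List M
  | _, [] => []
  | P, a :: w => κ P a :: cutColours κ (P * a) w

theorem cutColours_append (κ : M → M → M) (P : M) (x y : List M) :
    cutColours κ P (x ++ y) = cutColours κ P x ++ cutColours κ (P * x.prod) y := by
  induction x generalizing P with
  | nil => simp [cutColours]
  | cons a x ih => simp [cutColours, ih, mul_assoc]

theorem length_cutColours (κ : M → M → M) (P : M) (x : List M) :
    (cutColours κ P x).length = x.length := by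
  induction x generalizing P with
  | nil => rfl
  | cons a x ih => simp [cutColours, ih]

theorem exists_first_colour (κ : M → M → M) (c P : M) (m : List M) :
    c ∉ cutColours κ P m ∨ ∃ x y₀ y, m = x ++ y₀ :: y ∧ c ∉ cutColours κ P x ∧
      κ (P * x.prod) y₀ = c := by
  induction m generalizing P with
  | nil => left; simp [cutColours]
  | cons a m ih =>
    by_cases h : κ P a = c
    · exact .inr ⟨[], a, m, rfl, by simp [cutColours], by simpa⟩
    · rcases ih (P * a) with h' | ⟨x, y₀, y, rfl, hx, hy⟩
      · left; simp [cutColours, h', Ne.symm h]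
      · exact .inr ⟨a :: x, y₀, y, rfl, by simp [cutColours, hx, Ne.symm h],
          by simpa [mul_assoc] using hy⟩

/-- A word that stays in the `J`-class of `b` when read after `P`. -/
def StaysFrom (b P : M) (w : List M) : Prop :=
  GreenR P b ∧ (∀ x ∈ w, GreenJ x b) ∧ GreenJ (P * w.prod) b

/-- `κ` is a colouring of cuts for the `J`-class of `b`, with idempotents given by `ε`. -/
structure IsCutColouring (b : M) (κ : M → M → M) (ε : M → M) : Prop where
  mem : ∀ P a, GreenR P b → GreenJ a b → GreenJ (κ P a) b
  eq : ∀ P a s a', GreenR P b → GreenJ a b → GreenJ a' b → GreenJ (P * (a * s)) b →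
      κ P a = κ (P * (a * s)) a' →
      a * s = ε (κ P a) ∧ a * s * (a * s) = a * s ∧ GreenJ (a * s) b

/-- The colours of unstable idempotents occur at most `n + 1` times in `l`. -/
def Firm [DecidableEq M] (S : StabStructure M) (n : ℕ) (b : M) (ε : M → M) (l : List M) : Prop :=
  ∀ c, ¬ GreenJ (S.sharp (ε c)) b → l.count c ≤ n + 1

variable {b P : M} {κ : M → M → M} {ε : M → M}

theorem Firm.sublist [DecidableEq M] {l l' : List M} (h : S.Firm n b ε l) (hl : l'.Sublist l) :
    S.Firm n b ε l' := fun c hc => (hl.count_le c).trans (h c hc)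

/-- The words read by the left-to-right decomposition without falling out of the `J`-class
of `j`. -/
def Pending [DecidableEq M] (S : StabStructure M) (n : ℕ) (j : M) (w : List M) : Prop :=
  (∃ a, w = [a] ∧ GreenJ a j) ∨
  ∃ b P κ ε, GreenJ b j ∧ IsCutColouring b κ ε ∧ w ≠ [] ∧ StaysFrom b P w ∧
    S.Firm n b ε (cutColours κ P w)

namespace StaysFrom

theorem left {x y : List M} (h : StaysFrom b P (x ++ y)) : StaysFrom b P x := by
  refine ⟨h.1, fun z hz => h.2.1 z (by simp [hz]), h.2.2.of_le ?_ ?_⟩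
  · rw [List.prod_append, ← mul_assoc]; exact GreenJLe.mul_right _ _
  · exact (GreenJLe.mul_right _ _).trans h.1.greenJ.1

theorem prod {w : List M} (h : StaysFrom b P w) (hw : w ≠ []) : GreenJ w.prod b := by
  refine h.2.2.of_le (GreenJLe.mul_left _ _) ?_
  match w, hw with
  | a :: w, _ =>
    rw [List.prod_cons]
    exact (GreenJLe.mul_right _ _).trans (h.2.1 a (by simp)).1

variable [Finite M]

theorem right {x y : List M} (h : StaysFrom b P (x ++ y)) : StaysFrom b (P * x.prod) y :=
  ⟨(h.1.greenJ.greenR_mul h.left.2.2).symm.trans h.1, fun z hz => h.2.1 z (by simp [hz]), by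
    have := h.2.2
    rwa [List.prod_append, ← mul_assoc] at this⟩

theorem tail {a : M} {y : List M} (h : StaysFrom b P (a :: y)) : StaysFrom b (P * a) y := by
  simpa using StaysFrom.right (x := [a]) (y := y) h

/-- By stability `P * w.prod` is `L`-equivalent to `w.prod`, and `L` is preserved by right
multiplication. So whether the next letter leaves the class can be tested without the prefix `P`. -/
theorem concat {w : List M} {a : M} (h : StaysFrom b P w) (hw : w ≠ []) (ha : GreenJ a b)
    (hwa : GreenJ (w.prod * a) b) : StaysFrom b P (w ++ [a]) := by
  refine ⟨h.1, fun z hz => ?_, ?_⟩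
  · rcases List.mem_append.1 hz with hz | hz
    · exact h.2.1 z hz
    · rwa [List.mem_singleton.1 hz]
  · obtain ⟨d, hd⟩ := ((h.prod hw).greenL_mul h.2.2).1
    rw [List.prod_append, List.prod_singleton]
    refine ⟨(GreenJLe.mul_right _ _).trans h.1.greenJ.1, hwa.2.trans ⟨d, 1, ?_⟩⟩
    conv_lhs => rw [hd]
    simp only [mul_assoc, mul_one]

theorem colour_mem (hκ : IsCutColouring b κ ε) {w : List M} (h : StaysFrom b P w) :
    ∀ d ∈ cutColours κ P w, GreenJ d b := by
  induction w generalizing P with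
  | nil => simp [cutColours]
  | cons a w ih =>
    intro d hd
    rcases List.mem_cons.1 hd with rfl | hd
    · exact hκ.mem P a h.1 (h.2.1 a (by simp))
    · exact ih h.tail d hd

end StaysFrom

variable [Finite M] [DecidableEq M]

/-- A word whose first letter has colour `c` is cut before its letters of colour `c`. -/
theorem IsCutColouring.exists_run_last (hκ : IsCutColouring b κ ε) {C : Finset M} {c : M} {p : ℕ}
    (ih : ∀ P a m, StaysFrom b P (a :: m) → S.Firm n b ε (cutColours κ P (a :: m)) →
      (∀ d ∈ cutColours κ (P * a) m, d ∈ C.erase c) →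
      S.ExactComp n p (a :: m).prod (a :: m)) :
    ∀ (N : ℕ) (P a : M) (m : List M), m.length ≤ N → StaysFrom b P (a :: m) →
      (∀ d, d ≠ c → ¬ GreenJ (S.sharp (ε d)) b → (cutColours κ P (a :: m)).count d ≤ n + 1) →
      κ P a = c → (∀ d ∈ cutColours κ (P * a) m, d ∈ C) →
      ∃ (ws : List (List M)) (l₀ : M) (l X Y : List M),
        a :: m = ws.flatten ++ l₀ :: l ∧ (∀ x ∈ ws, S.ExactComp n p (ε c) x ∧ x.prod = ε c) ∧
        S.ExactComp n p (l₀ :: l).prod (l₀ :: l) ∧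
        ws.length + 1 = (cutColours κ P (a :: m)).count c ∧
        (ws ≠ [] → ε c * ε c = ε c ∧ GreenJ (ε c) b) ∧
        cutColours κ P (a :: m) = X ++ c :: Y ∧ Y.length = l.length ∧ c ∉ Y := by
  intro N
  induction N with
  | zero =>
    intro P a m hm hP hfirm hc hC
    obtain rfl : m = [] := by simpa using hm
    exact ⟨[], a, [], [], [], rfl, by simp, by simpa using HasComp.leaf (x := a) rfl,
      by simp [cutColours, hc], by simp, by simp [cutColours, hc], rfl, by simp⟩
  | succ N ihN =>
    intro P a m hm hP hfirm hc hC
    -- In a single piece the colour `c` occurs only at the first letter, within any bound `n + 1`.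
    -- This is why `hfirm` may exempt `c`, which `exists_drop` needs.
    have firm_of : ∀ x y : List M, m = x ++ y → c ∉ cutColours κ (P * a) x →
        S.Firm n b ε (cutColours κ P (a :: x)) := by
      intro x y hxy hcx d hd
      by_cases hdc : d = c
      · subst hdc
        simp [cutColours, hc, List.count_eq_zero_of_not_mem hcx]
      · refine le_trans (List.Sublist.count_le _ ?_) (hfirm d hdc hd)
        rw [hxy, ← List.cons_append, cutColours_append]
        exact List.sublist_append_left _ _
    rcases exists_first_colour κ c (P * a) m with hcm | ⟨x, y₀, y, rfl, hcx, hy⟩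
    · refine ⟨[], a, m, [], cutColours κ (P * a) m, rfl, by simp, ?_, ?_, by simp, ?_,
        length_cutColours _ _ _, hcm⟩
      · exact ih P a m hP (firm_of m [] (by simp) hcm) fun d hd =>
          Finset.mem_erase.2 ⟨fun h => hcm (h ▸ hd), hC d hd⟩
      · simp [cutColours, hc, List.count_eq_zero_of_not_mem hcm]
      · simp [cutColours, hc]
    · have hP1 : StaysFrom b P (a :: x) := StaysFrom.left (y := y₀ :: y) hP
      have hP2 : StaysFrom b (P * (a :: x).prod) (y₀ :: y) :=
        StaysFrom.right (x := a :: x) hP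
      have hcol : cutColours κ P (a :: (x ++ y₀ :: y)) =
          c :: (cutColours κ (P * a) x ++ cutColours κ (P * (a :: x).prod) (y₀ :: y)) := by
        simp [cutColours, hc, cutColours_append, mul_assoc]
      have hy' : κ (P * (a * x.prod)) y₀ = c := by rwa [← mul_assoc]
      obtain ⟨ht, hidem, hJ⟩ := hκ.eq P a x.prod y₀ hP.1 (hP.2.1 a (by simp))
        (hP2.2.1 y₀ (by simp)) (by simpa using hP1.2.2) (by rw [hc, hy'])
      rw [hc] at ht
      obtain ⟨ws, l₀, l, X, Y, h1, h2, h3, h4, h5, h6, h7, h8⟩ :=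
        ihN (P * (a :: x).prod) y₀ y (by simp at hm; omega) hP2
          (fun d hdc hd => le_trans (List.Sublist.count_le _ (by
            rw [hcol]
            exact (List.sublist_append_right _ _).trans (List.sublist_cons_self _ _)))
            (hfirm d hdc hd))
          (by simpa using hy') (fun d hd => hC d (by
            rw [cutColours_append]
            simp only [cutColours, List.mem_append, List.mem_cons]
            exact .inr (.inr (by simpa [mul_assoc] using hd))))
      have hx : S.ExactComp n p (ε c) (a :: x) := by
        rw [← ht, ← List.prod_cons]
        refine ih P a x hP1 (firm_of x _ rfl hcx) fun d hd =>
          Finset.mem_erase.2 ⟨fun h => hcx (h ▸ hd), hC d ?_⟩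
        rw [cutColours_append]
        exact List.mem_append_left _ hd
      refine ⟨(a :: x) :: ws, l₀, l, c :: (cutColours κ (P * a) x ++ X), Y, ?_, ?_, h3, ?_, ?_, ?_,
        h7, h8⟩
      · rw [List.flatten_cons, List.append_assoc, ← h1]; rfl
      · intro z hz
        rcases List.mem_cons.1 hz with rfl | hz
        · exact ⟨hx, by rw [List.prod_cons, ht]⟩
        · exact h2 z hz
      · rw [hcol, List.count_cons_self, List.count_append,
          List.count_eq_zero_of_not_mem hcx, List.length_cons, h4]
        omega
      · exact fun _ => ⟨by rw [← ht]; exact hidem, by rw [← ht]; exact hJ⟩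
      · rw [hcol, h6]; simp

/-- The bounds on runs in a firm word. -/
theorem SharpLaws.run_length_or (hS : S.SharpLaws) {c : M} {l : List M} {k : ℕ}
    (hfirm : S.Firm n b ε l) (hk : k + 1 ≤ l.count c)
    (he : 0 < k → ε c * ε c = ε c ∧ GreenJ (ε c) b) : k ≤ n ∨ S.sharp (ε c) = ε c := by
  by_cases hc : GreenJ (S.sharp (ε c)) b
  · rcases Nat.eq_zero_or_pos k with rfl | hk
    · exact .inl (Nat.zero_le _)
    · exact .inr (hS.sharp_eq (he hk).1 (he hk).2 hc)
  · have := hfirm c hc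
    exact .inl (by omega)

/-- Induction on the number of colours available after the first letter. Set the first letter aside
and cut at every occurrence of the colour of the second: the pieces then use one colour fewer after
their own first letters. -/
theorem IsCutColouring.exactComp (hS : S.SharpLaws) (hκ : IsCutColouring b κ ε) :
    ∀ (k : ℕ) (C : Finset M), C.card = k → ∀ (P a : M) (m : List M), StaysFrom b P (a :: m) →
      S.Firm n b ε (cutColours κ P (a :: m)) → (∀ d ∈ cutColours κ (P * a) m, d ∈ C) →
      S.ExactComp n (3 * k) (a :: m).prod (a :: m) := by
  intro k
  induction k with
  | zero =>
    intro C hC P a m hP hfirm hm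
    obtain rfl := Finset.card_eq_zero.1 hC
    cases m with
    | nil => simpa using HasComp.leaf (x := a) rfl
    | cons a' m => exact absurd (hm (κ (P * a) a') (by simp [cutColours])) (by simp)
  | succ k ih =>
    intro C hC P a m hP hfirm hm
    cases m with
    | nil => simpa using HasComp.leaf (x := a) rfl
    | cons a' m =>
      have hcC := hm (κ (P * a) a') (by simp [cutColours])
      have hfirm' : S.Firm n b ε (cutColours κ (P * a) (a' :: m)) :=
        hfirm.sublist (List.sublist_cons_self _ _)
      obtain ⟨ws, l₀, l, X, Y, h1, h2, h3, h4, h5, -⟩ :=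
        hκ.exists_run_last (C := C) (c := κ (P * a) a') (p := 3 * k)
          (ih (C.erase (κ (P * a) a')) (by rw [Finset.card_erase_of_mem hcC, hC]; rfl))
          m.length (P * a) a' m le_rfl hP.tail (fun d _ hd => hfirm' d hd) rfl
          (fun d hd => hm d (by simp [cutColours, hd]))
      have hn := hS.run_length_or hfirm' h4.le
        fun h => h5 (by rintro rfl; simp at h)
      -- The pieces have height `3 * k`; the run, its junction with the last piece, and the junction
      -- with the letter `a` set aside account for the three further levels.
      have h6 := hS.absorb (fun h => (h5 h).1) h2 hn (h3.mono (Nat.le_succ _))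
      rw [← List.prod_append, ← h1] at h6
      have h7 := hS.binary (HasComp.leaf (x := a) (a := a) rfl) h6
      rw [List.prod_cons]
      exact h7

/-! ### Splitting a word at one `J`-class -/

section Class

variable {C : Finset M}

theorem IsCutColouring.exactComp_erase (hS : S.SharpLaws) (hκ : IsCutColouring b κ ε)
    {c : M} (hc : c ∈ C) (P a : M) (m : List M) (h : StaysFrom b P (a :: m))
    (hf : S.Firm n b ε (cutColours κ P (a :: m)))
    (hm : ∀ d ∈ cutColours κ (P * a) m, d ∈ C.erase c) :
    S.ExactComp n (3 * (C.card - 1)) (a :: m).prod (a :: m) :=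
  hκ.exactComp hS _ (C.erase c) (Finset.card_erase_of_mem hc) P a m h hf hm

/-- Firm words that stay in a `J`-class, extended by some suffix of length at most one. -/
theorem IsCutColouring.exactComp_append (hS : S.SharpLaws) (hκ : IsCutColouring b κ ε)
    (hC : ∀ x, GreenJ x b → x ∈ C) {w s : List M} (hw : w ≠ []) (h : StaysFrom b P w)
    (hf : S.Firm n b ε (cutColours κ P w)) (hs : s.length ≤ 1) :
    S.ExactComp n (3 * C.card - 1) (w.prod * s.prod) (w ++ s) := by
  obtain ⟨a, m, rfl⟩ := List.exists_cons_of_ne_nil hw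
  have hcol := h.colour_mem hκ
  have hc : κ P a ∈ C := hC _ (hcol _ (by simp [cutColours]))
  have hpos : 0 < C.card := Finset.card_pos.2 ⟨_, hc⟩
  obtain ⟨ws, l₀, l, X, Y, h1, h2, h3, h4, h5, -⟩ :=
    hκ.exists_run_last (hκ.exactComp_erase hS hc) m.length P a m le_rfl h
      (fun d _ hd => hf d hd) rfl (fun d hd => hC _ (hcol _ (by simp [cutColours, hd])))
  have hn := hS.run_length_or hf h4.le fun h => h5 (by rintro rfl; simp at h)
  -- The suffix is attached to the last piece, on the same level as the run node, and so costs no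
  -- extra height. As the pivot is the colour of the first letter, no letter is set aside either;
  -- hence `3 * C.card - 1`.
  have h3' : S.ExactComp n (3 * (C.card - 1) + 1) ((l₀ :: l).prod * s.prod) (l₀ :: l ++ s) := by
    match s, hs with
    | [], _ => simpa using h3.mono (Nat.le_succ _)
    | [y], _ => simpa using hS.binary h3 (HasComp.leaf (x := y) (a := y) rfl)
  have h6 := hS.absorb (fun h => (h5 h).1) h2 hn h3'
  rw [← mul_assoc, ← List.prod_append, ← List.append_assoc, ← h1] at h6
  exact h6.mono (by omega)

/-- A word that stops being firm at the next cut has a computation falling out of the class. -/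
theorem IsCutColouring.exists_drop (hS : S.SharpLaws) (hκ : IsCutColouring b κ ε)
    (hC : ∀ x, GreenJ x b → x ∈ C) {w : List M} {a : M} (h : StaysFrom b P (w ++ [a]))
    (hf : S.Firm n b ε (cutColours κ P w)) (hf' : ¬ S.Firm n b ε (cutColours κ P (w ++ [a]))) :
    ∃ v, ¬ GreenJ v b ∧ S.ExactComp n (3 * C.card - 1) v w := by
  obtain ⟨c, hc, hcount⟩ : ∃ c, ¬ GreenJ (S.sharp (ε c)) b ∧
      n + 1 < (cutColours κ P (w ++ [a])).count c := by
    by_contra! hcon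
    exact hf' hcon
  have hcol : cutColours κ P (w ++ [a]) = cutColours κ P w ++ [κ (P * w.prod) a] := by
    rw [cutColours_append]; rfl
  have hcw := hf c hc
  -- Only the count of the newly added colour has changed, so the overfull colour is that of the cut
  -- before `a`.
  have hca : κ (P * w.prod) a = c := by
    by_contra hne
    rw [hcol, List.count_append, List.count_singleton, if_neg (by simpa using hne)] at hcount
    omega
  have hcolJ := h.colour_mem hκ
  have hcC : c ∈ C := hC _ (hcolJ _ (by simp [hcol, hca]))
  have hpos : 0 < C.card := Finset.card_pos.2 ⟨_, hcC⟩
  rw [hcol, List.count_append, hca, List.count_singleton_self] at hcount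
  rcases exists_first_colour κ c P w with hcm | ⟨x, y₀, y, rfl, hcx, hy⟩
  · rw [List.count_eq_zero_of_not_mem hcm] at hcount
    omega
  have happ : x ++ y₀ :: y ++ [a] = x ++ y₀ :: (y ++ [a]) := by simp
  rw [happ] at h hcol hcolJ
  have h' := h.right
  have hcol2 : cutColours κ P (x ++ y₀ :: (y ++ [a])) =
    cutColours κ P x ++ cutColours κ (P * x.prod) (y₀ :: (y ++ [a])) := cutColours_append _ _ _ _
  have hfd : ∀ d, d ≠ c → ¬ GreenJ (S.sharp (ε d)) b →
      (cutColours κ (P * x.prod) (y₀ :: (y ++ [a]))).count d ≤ n + 1 := by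
    intro d hdc hd
    have h1 := hf d hd
    have h2 : (cutColours κ P (x ++ y₀ :: (y ++ [a]))).count d ≤ n + 1 := by
      rw [hcol, List.count_append, hca, List.count_singleton,
        if_neg (by simpa using hdc.symm)]
      exact h1
    rw [hcol2, List.count_append] at h2
    omega
  obtain ⟨ws, l₀, l, X, Y, h1, h2, h3, h4, h5, h6, h7, h8⟩ :=
    hκ.exists_run_last (hκ.exactComp_erase hS hcC) (y ++ [a]).length (P * x.prod) y₀ (y ++ [a])
      le_rfl h' hfd hy (fun d hd => hC _ (hcolJ _ (by
        rw [hcol2]; simp [cutColours, hd])))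
  -- The last colour of the extended word is `c`, so the piece after the last cut of colour `c` is
  -- just the letter `a`, and the blocks end exactly where `w` ends.
  have hl : l = [] := by
    have h9 : cutColours κ P x ++ (X ++ c :: Y) = cutColours κ P (x ++ y₀ :: y) ++ [c] := by
      rw [← h6, ← hcol2, hcol, hca]
    rcases List.eq_nil_or_concat' Y with rfl | ⟨Y', d, rfl⟩
    · simpa using h7.symm
    · have h10 : cutColours κ P x ++ (X ++ c :: Y') ++ [d] =
          cutColours κ P (x ++ y₀ :: y) ++ [c] := by
        rw [← h9]; simp
      have := (List.append_inj' h10 rfl).2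
      simp only [List.cons.injEq, and_true] at this
      simp [this] at h8
  subst hl
  have h11 : y₀ :: y = ws.flatten :=
    (List.append_inj' (show (y₀ :: y) ++ [a] = ws.flatten ++ [l₀] from h1) rfl).1
  -- All occurrences of `c`, at least `n + 2`, lie after `x`, and they delimit one block fewer than
  -- their number.
  have hwl : n < ws.length := by
    have e1 : (cutColours κ P (x ++ y₀ :: (y ++ [a]))).count c =
        (cutColours κ P (x ++ y₀ :: y)).count c + 1 := by
      rw [hcol, List.count_append, hca, List.count_singleton_self]
    rw [hcol2, List.count_append, List.count_eq_zero_of_not_mem hcx] at e1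
    omega
  obtain ⟨he, heJ⟩ := h5 (by rintro rfl; simp at hwl)
  have hrun := hS.stabRun he (fun x hx => (h2 x hx).1) hwl
  rw [← h11] at hrun
  cases x with
  | nil => exact ⟨_, hc, HasComp.mono hrun (by omega)⟩
  | cons x₀ x =>
    refine ⟨(x₀ :: x).prod * S.sharp (ε c), hS.not_greenJ_mul_sharp he heJ hc _, ?_⟩
    have hx : S.ExactComp n (3 * (C.card - 1)) (x₀ :: x).prod (x₀ :: x) := by
      refine hκ.exactComp_erase hS hcC P x₀ x h.left (hf.sublist ?_) fun d hd =>
        Finset.mem_erase.2 ⟨?_, hC _ (hcolJ _ ?_)⟩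
      · rw [cutColours_append]; exact List.sublist_append_left _ _
      · rintro rfl
        exact hcx (by simp [cutColours, hd])
      · rw [hcol2]; simp [cutColours, hd]
    exact HasComp.mono (hS.binary (HasComp.mono hx (Nat.le_succ _)) hrun) (by omega)

theorem Pending.exactComp_append (hS : S.SharpLaws) {j : M} (hC : ∀ x, GreenJ x j → x ∈ C)
    {w s : List M} (h : S.Pending n j w) (hs : s.length ≤ 1) :
    S.ExactComp n (3 * C.card - 1) (w.prod * s.prod) (w ++ s) := by
  rcases h with ⟨a, rfl, ha⟩ | ⟨b, P, κ, ε, hb, hκ, hw, hP, hf⟩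
  · have hpos : 0 < C.card := Finset.card_pos.2 ⟨_, hC a ha⟩
    match s, hs with
    | [], _ => simpa using HasComp.leaf (x := a) rfl
    | [y], _ =>
      refine HasComp.mono (p := 1) ?_ (by omega)
      simpa using hS.binary (p := 0) (HasComp.leaf (x := a) rfl) (HasComp.leaf (x := y) rfl)
  · exact hκ.exactComp_append hS (fun x hx => hC x (hx.trans hb)) hw hP hf hs

/-- If the extended word is no longer firm, `exists_drop` gives a computation for `w` alone that
leaves the class. A single letter is treated separately: a suitable prefix for the colouring is only
known to exist once a second letter follows inside the class. -/
theorem Pending.concat (hS : S.SharpLaws) (hn : 1 ≤ n) {j a : M}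
    (hC : ∀ x, GreenJ x j → x ∈ C) {w : List M} (h : S.Pending n j w) (ha : GreenJ a j)
    (hwa : GreenJ (w.prod * a) j) :
    S.Pending n j (w ++ [a]) ∨ ∃ v, ¬ GreenJ v j ∧ S.ExactComp n (3 * C.card - 1) v w := by
  rcases h with ⟨a', rfl, ha'⟩ | ⟨b, P, κ, ε, hb, hκ, hw, hP, hf⟩
  · left; right
    rw [List.prod_singleton] at hwa
    have h1 : GreenJ a a' := ha.trans ha'.symm
    have h2 : GreenJ (a' * a) a' := hwa.trans ha'.symm
    obtain ⟨g, hg, hga⟩ := h1.exists_greenR_mul h2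
    obtain ⟨κ, ε, hκ1, hκ2⟩ := exists_cut_colouring a'
    have hs : StaysFrom a' g [a'] :=
      ⟨hg, by simpa using GreenJ.refl a', by simpa using hga⟩
    refine ⟨a', g, κ, ε, ha', ⟨hκ1, hκ2⟩, by simp,
      hs.concat (by simp) h1 (by simpa using h2), fun c _ => ?_⟩
    -- A two-letter word has only two colours, and `2 ≤ n + 1` by `hn`.
    refine List.count_le_length.trans ?_
    rw [length_cutColours]
    simpa using hn
  · have hP' := hP.concat hw (ha.trans hb.symm) (hwa.trans hb.symm)
    by_cases hf' : S.Firm n b ε (cutColours κ P (w ++ [a]))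
    · exact .inl (.inr ⟨b, P, κ, ε, hb, hκ, by simp, hP', hf'⟩)
    · obtain ⟨v, hv, hvw⟩ := hκ.exists_drop hS (fun x hx => hC x (hx.trans hb)) hP' hf hf'
      exact .inr ⟨v, fun h => hv (h.trans hb.symm), hvw⟩

/-- The left-to-right decomposition of a word over a two-sided ideal `L` in which `j` is
maximal. -/
theorem exists_blocks (hS : S.SharpLaws) (hn : 1 ≤ n) {j : M} {L : Set M}
    (hC : ∀ x, GreenJ x j → x ∈ C) (hj : ∀ x ∈ L, GreenJLe j x → GreenJ x j) (u : List M)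
    (hu : ∀ x ∈ u, x ∈ L) :
    ∃ (bs : List (List M)) (w : List M), u = bs.flatten ++ w ∧
      (∀ x ∈ bs, ∃ v, ¬ GreenJ v j ∧ S.ExactComp n (3 * C.card - 1) v x) ∧
      (w = [] ∨ S.Pending n j w) := by
  induction u using List.reverseRecOn with
  | nil => exact ⟨[], [], rfl, by simp, .inl rfl⟩
  | append_singleton u a ih =>
    obtain ⟨bs, w, rfl, hbs, hw⟩ := ih fun x hx => hu x (by simp [hx])
    have haL : a ∈ L := hu a (by simp)
    have extend : ∀ x, (∃ v, ¬ GreenJ v j ∧ S.ExactComp n (3 * C.card - 1) v x) →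
        ∀ y ∈ bs ++ [x], ∃ v, ¬ GreenJ v j ∧ S.ExactComp n (3 * C.card - 1) v y := by
      intro x hx y hy
      rcases List.mem_append.1 hy with hy | hy
      · exact hbs y hy
      · rwa [List.mem_singleton.1 hy]
    rcases hw with rfl | hw
    · by_cases ha : GreenJ a j
      · exact ⟨bs, [a], by simp, hbs, .inr (.inl ⟨a, rfl, ha⟩)⟩
      · exact ⟨bs ++ [[a]], [], by simp, extend _ ⟨a, ha, HasComp.leaf rfl⟩, .inl rfl⟩
    · by_cases hwa : GreenJ (w.prod * a) j
      · have ha : GreenJ a j := hj a haL (hwa.2.trans (GreenJLe.mul_left _ _))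
        rcases hw.concat hS hn hC ha hwa with h | h
        · exact ⟨bs, w ++ [a], by simp, hbs, .inr h⟩
        · exact ⟨bs ++ [w], [a], by simp, extend _ h, .inr (.inl ⟨a, rfl, ha⟩)⟩
      · refine ⟨bs ++ [w ++ [a]], [], by simp, extend _ ⟨_, hwa, ?_⟩, .inl rfl⟩
        simpa using hw.exactComp_append hS hC (s := [a]) (by simp)

end Class

end StabStructure

/-! ### Induction over two-sided ideals -/

namespace StabStructure

section

variable {M : Type u} [Monoid M] {S : StabStructure M} {n : ℕ}

/-- Stabilisation does not leave a two-sided ideal because `e♯ = e * e♯`. -/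
theorem SharpLaws.value_mem (hS : S.SharpLaws) {L : Set M}
    (hL : ∀ x ∈ L, ∀ a c, a * x * c ∈ L) {p : ℕ} {x : M} {u : List M}
    (h : S.ExactComp n p x u) (hu : ∀ y ∈ u, y ∈ L) : x ∈ L := by
  have hmul : ∀ x ∈ L, ∀ c, x * c ∈ L := fun x hx c => by simpa using hL x hx 1 c
  refine HasComp.induction (Q := fun p x u => (∀ y ∈ u, y ∈ L) → x ∈ L) ?_ ?_ h hu
  · rintro p x a rfl hu
    exact hu x (by simp)
  · intro p x ys ws hw hx hu
    have hys : ∀ y ∈ ys, y ∈ L := by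
      intro y hy
      rw [List.forall₂_iff_get] at hw
      obtain ⟨i, hi, rfl⟩ := List.mem_iff_getElem.1 hy
      have hi' : i < ws.length := hw.1 ▸ hi
      exact (hw.2 i hi hi').2 fun z hz =>
        hu z (List.mem_flatten.2 ⟨_, List.getElem_mem hi', hz⟩)
    rcases hx with ⟨y₁, y₂, rfl, rfl⟩ | ⟨h1, h2, e, he, hy, rfl⟩ | ⟨h1, e, he, hy, rfl⟩
    · rw [hS.mul_eq]
      exact hmul _ (hys _ (by simp)) _
    · obtain ⟨z, hz⟩ := List.exists_mem_of_length_pos (l := ys) (by omega)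
      exact hy z hz ▸ hys z hz
    · obtain ⟨z, hz⟩ := List.exists_mem_of_length_pos (l := ys) (by omega)
      rw [← hS.mul_sharp e ((hS.mul_eq e e).symm.trans he)]
      exact hmul _ (hy z hz ▸ hys z hz) _

/-- Choose `j` with the largest number of elements of `L` below it in the `J`-preorder; an element
above `j` then has the same ones below it, itself included. -/
theorem exists_greenJ_maximal {L : Finset M} (hL : L.Nonempty) :
    ∃ j ∈ L, ∀ x ∈ L, GreenJLe j x → GreenJ x j := by
  classical
  obtain ⟨j, hj, hmax⟩ := L.exists_max_image (fun j => (L.filter (GreenJLe · j)).card) hL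
  refine ⟨j, hj, fun x hx hjx => ⟨?_, hjx⟩⟩
  have hsub : L.filter (GreenJLe · j) ⊆ L.filter (GreenJLe · x) := fun y hy => by
    rw [Finset.mem_filter] at hy ⊢
    exact ⟨hy.1, hy.2.trans hjx⟩
  have := Finset.eq_of_subset_of_card_le hsub (hmax x hx)
  have hxx : x ∈ L.filter (GreenJLe · x) := Finset.mem_filter.2 ⟨hx, .refl x⟩
  rw [← this] at hxx
  exact (Finset.mem_filter.1 hxx).2

variable [Finite M]

/-- Removing a maximal `J`-class from a two-sided ideal leaves a two-sided ideal, which contains the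
values of the blocks. The induction hypothesis computes the word of these values. -/
theorem SharpLaws.exists_exactComp_of_ideal (hS : S.SharpLaws) (hn : 1 ≤ n) :
    ∀ (k : ℕ) (L : Finset M), L.card = k → (∀ x ∈ L, ∀ a c, a * x * c ∈ L) →
      ∀ u : List M, u ≠ [] → (∀ x ∈ u, x ∈ L) → ∃ v, S.ExactComp n (3 * k) v u := by
  classical
  intro k
  induction k using Nat.strong_induction_on with
  | _ k ih =>
    intro L hk hL u hu huL
    obtain ⟨a, ha⟩ := List.exists_mem_of_ne_nil u hu
    obtain ⟨j, hjL, hj⟩ := exists_greenJ_maximal ⟨a, huL a ha⟩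
    have hC : ∀ x, GreenJ x j → x ∈ L.filter (GreenJ · j) := by
      intro x hx
      obtain ⟨a, c, rfl⟩ := hx.1
      exact Finset.mem_filter.2 ⟨hL j hjL a c, hx⟩
    have hcard : (L.filter (GreenJ · j)).card + (L.filter (¬ GreenJ · j)).card = k := by
      rw [← hk]; exact Finset.card_filter_add_card_filter_not _
    set C := L.filter (GreenJ · j) with hCdef
    set L' := L.filter (¬ GreenJ · j) with hL'def
    have hCpos : 0 < C.card := Finset.card_pos.2 ⟨j, hC j (.refl j)⟩
    have hL' : ∀ x ∈ L', ∀ a c, a * x * c ∈ L' := by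
      intro x hx a c
      rw [hL'def, Finset.mem_filter] at hx ⊢
      exact ⟨hL x hx.1 a c, fun h => hx.2 (hj x hx.1 (h.2.trans ⟨a, c, rfl⟩))⟩
    obtain ⟨bs, w, rfl, hbs, hw⟩ := exists_blocks (L := L) hS hn hC hj u huL
    have hblocks : ∀ bs' : List (List M), (∀ x ∈ bs', x ∈ bs) → ∃ vs : List M,
        List.Forall₂ (S.ExactComp n (3 * C.card - 1)) vs bs' ∧ ∀ v ∈ vs, v ∈ L' := by
      intro bs'
      induction bs' with
      | nil => exact fun _ => ⟨[], .nil, by simp⟩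
      | cons x bs' ih' =>
        intro hx
        obtain ⟨vs, h1, h2⟩ := ih' fun y hy => hx y (by simp [hy])
        obtain ⟨v, hv, hvx⟩ := hbs x (hx x (by simp))
        refine ⟨v :: vs, .cons hvx h1, fun y hy => ?_⟩
        rcases List.mem_cons.1 hy with rfl | hy
        · refine Finset.mem_filter.2 ⟨hS.value_mem (L := L) hL hvx fun z hz => huL z ?_, hv⟩
          exact List.mem_append_left _ (List.mem_flatten.2 ⟨x, hx x (by simp), hz⟩)
        · exact h2 y hy
    have hwc : ∀ w, S.Pending n j w → S.ExactComp n (3 * C.card - 1) w.prod w := fun w hw => by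
      simpa using hw.exactComp_append hS hC (s := []) (by simp)
    rcases eq_or_ne bs [] with rfl | hne
    · rcases hw with rfl | hw
      · simp at hu
      · exact ⟨_, by simpa using (hwc w hw).mono (by omega)⟩
    · obtain ⟨vs, h1, h2⟩ := hblocks bs fun _ h => h
      have hvs : vs ≠ [] := by
        rintro rfl
        cases h1
        exact hne rfl
      obtain ⟨v, hv⟩ := ih L'.card (by omega) L' rfl hL' vs hvs h2
      -- The height is now `3 * L'.card + (3 * C.card - 1)`; the level saved in the blocks is spent
      -- on joining the remainder `w`.
      have hflat := hv.subst h1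
      rcases hw with rfl | hw
      · exact ⟨v, by simpa using hflat.mono (by omega)⟩
      · refine ⟨v * w.prod, (hS.binary hflat ((hwc w hw).mono (by omega))).mono (by omega)⟩

theorem SharpLaws.exists_exactComp (hS : S.SharpLaws) (n : ℕ) {u : List M} (hu : u ≠ []) :
    ∃ v, S.ExactComp n (3 * Nat.card M) v u := by
  have := Fintype.ofFinite M
  have h : ∀ n, 1 ≤ n → ∃ v, S.ExactComp n (3 * Nat.card M) v u := fun n hn => by
    rw [Nat.card_eq_fintype_card]
    exact hS.exists_exactComp_of_ideal hn _ Finset.univ rfl (by simp) u hu (by simp)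
  rcases Nat.eq_zero_or_pos n with rfl | hn
  -- A `1`-computation has no idempotent nodes, since they need two children; its other nodes are
  -- also legitimate for the threshold `0`.
  · obtain ⟨v, hv⟩ := h 1 le_rfl
    refine ⟨v, HasComp.induction (Q := fun p x u => S.ExactComp 0 p x u)
      (fun p x a ha => HasComp.leaf ha) (fun p x ys ws hw hx => ?_) hv⟩
    refine HasComp.node (hw.imp fun _ _ h => h.2) ?_
    rcases hx with h | ⟨h1, h2, _⟩ | ⟨h1, h⟩
    · exact .inl h
    · omega
    · exact .inr (.inr ⟨by omega, h⟩)
  · exact h n hn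

end

section

variable {M : Type u} [PartialOrder M] {S : StabStructure M}

/-- The monoid underlying a stabilisation monoid. -/
abbrev IsStabilisationMonoid.toMonoid (hS : S.IsStabilisationMonoid) : Monoid M where
  mul := S.mul
  one := S.one
  mul_assoc := hS.mul_assoc
  one_mul := hS.one_mul
  mul_one := hS.mul_one

/-- Consistency with both factors equal to `e` gives `e♯ = e * e♯ * e`, from which absorption of `e`
on either side follows. -/
theorem IsStabilisationMonoid.sharpLaws (hS : S.IsStabilisationMonoid) :
    @SharpLaws M hS.toMonoid S := by
  let _ := hS.toMonoid
  have h : ∀ e : M, e * e = e → S.sharp e = e * S.sharp e * e := fun e he => by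
    have hi : S.Idem (S.mul e e) := by
      change S.Idem (e * e)
      rw [he]
      exact he
    have := hS.sharp_consistent e e hi hi
    change S.sharp (e * e) = e * S.sharp (e * e) * e at this
    rwa [he] at this
  refine ⟨fun _ _ => rfl, fun e he => hS.sharp_idem e he, fun e he => ?_, fun e he => ?_⟩
  · conv_lhs => rw [h e he]
    rw [← _root_.mul_assoc, ← _root_.mul_assoc, he, ← h e he]
  · conv_lhs => rw [h e he]
    rw [_root_.mul_assoc, he, ← h e he]

/-- Every word has computations of height at most `3|M|`. -/
theorem IsStabilisationMonoid.exists_exactComp (hS : S.IsStabilisationMonoid) (n : ℕ)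
    {u : List M} (hu : u ≠ []) : ∃ v, S.HasComp (fun y z => y = z) n (3 * Nat.card M) v u := by
  let _ := hS.toMonoid
  have := hS.finite
  exact hS.sharpLaws.exists_exactComp n hu

end

end StabStructure

/-! ## The stabilisation monoid of ideals -/

namespace StabStructure

variable {M : Type u} [PartialOrder M] {S : StabStructure M}

theorem mem_ideals_mul {P Q : LowerSet M} {x : M} :
    x ∈ S.ideals.mul P Q ↔ ∃ p ∈ P, ∃ q ∈ Q, x ≤ S.mul p q := by
  simp only [ideals, mem_lowerClosure, Set.mem_image2, SetLike.mem_coe]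
  constructor
  · rintro ⟨_, ⟨p, hp, q, hq, rfl⟩, h⟩
    exact ⟨p, hp, q, hq, h⟩
  · rintro ⟨p, hp, q, hq, h⟩
    exact ⟨_, ⟨p, hp, q, hq, rfl⟩, h⟩

theorem mul_mem_ideals_mul {P Q : LowerSet M} {p q : M} (hp : p ∈ P) (hq : q ∈ Q) :
    S.mul p q ∈ S.ideals.mul P Q := mem_ideals_mul.2 ⟨p, hp, q, hq, le_rfl⟩

theorem mem_ideals_one {x : M} : x ∈ S.ideals.one ↔ x ≤ S.one := Iff.rfl

theorem Idem.mul_mem {E : LowerSet M} (hE : S.ideals.Idem E) {a b : M} (ha : a ∈ E)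
    (hb : b ∈ E) : S.mul a b ∈ E := by
  have := mul_mem_ideals_mul (S := S) ha hb
  rwa [hE] at this

theorem Idem.exists_le_mul {E : LowerSet M} (hE : S.ideals.Idem E) {a : M} (ha : a ∈ E) :
    ∃ b ∈ E, ∃ c ∈ E, a ≤ S.mul b c := by
  rw [← mem_ideals_mul, hE]
  exact ha

namespace IsStabilisationMonoid

theorem pow_eq (hS : S.IsStabilisationMonoid) (a : M) (k : ℕ) :
    S.pow a k = hS.toMonoid.npow k a := by
  let _ := hS.toMonoid
  change S.pow a k = a ^ k
  induction k with
  | zero => rfl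
  | succ k ih => rw [pow_succ, ← ih]; rfl

theorem idem_pow_factorial (hS : S.IsStabilisationMonoid) (a : M) :
    S.Idem (S.pow a (Nat.card M).factorial) := by
  have := hS.finite
  rw [pow_eq hS]
  let _ := hS.toMonoid
  exact pow_factorial_natCard_idem a

theorem pow_of_idem (hS : S.IsStabilisationMonoid) {e : M} (he : S.Idem e) (k : ℕ) :
    S.pow e (k + 1) = e := by
  induction k with
  | zero => exact hS.one_mul e
  | succ k ih => rw [pow, ih]; exact he

theorem pow_le_pow (hS : S.IsStabilisationMonoid) {a b : M} (h : a ≤ b) (k : ℕ) :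
    S.pow a k ≤ S.pow b k := by
  induction k with
  | zero => exact le_rfl
  | succ k ih => exact hS.mul_le_mul _ _ _ _ ih h

theorem mul_sharp (hS : S.IsStabilisationMonoid) {e : M} (he : S.Idem e) :
    S.mul e (S.sharp e) = S.sharp e := by
  let _ := hS.toMonoid
  exact hS.sharpLaws.mul_sharp e he

theorem sharp_mul (hS : S.IsStabilisationMonoid) {e : M} (he : S.Idem e) :
    S.mul (S.sharp e) e = S.sharp e := by
  let _ := hS.toMonoid
  exact hS.sharpLaws.sharp_mul e he

theorem mul_mul_le (hS : S.IsStabilisationMonoid) {a a' b b' c c' : M} (ha : a ≤ a')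
    (hb : b ≤ b') (hc : c ≤ c') : S.mul (S.mul a b) c ≤ S.mul (S.mul a' b') c' :=
  hS.mul_le_mul _ _ _ _ (hS.mul_le_mul _ _ _ _ ha hb) hc

theorem pow_mem (hS : S.IsStabilisationMonoid) {E : LowerSet M} (hE : S.ideals.Idem E) {a : M}
    (ha : a ∈ E) (k : ℕ) : S.pow a (k + 1) ∈ E := by
  induction k with
  | zero => rwa [pow, pow, hS.one_mul]
  | succ k ih => exact hE.mul_mem ih ha

theorem pow_mul_mem (hS : S.IsStabilisationMonoid) {E : LowerSet M} (hE : S.ideals.Idem E)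
    {a b : M} (ha : a ∈ E) (hb : b ∈ E) (k : ℕ) : S.mul (S.pow a k) b ∈ E := by
  cases k with
  | zero => rwa [pow, hS.one_mul]
  | succ k => exact hE.mul_mem (pow_mem hS hE ha k) hb

/-- The elements of the stabilisation of an idempotent ideal. -/
theorem mem_ideals_sharp (hS : S.IsStabilisationMonoid) {E : LowerSet M}
    (hE : S.ideals.Idem E) {x : M} :
    x ∈ S.ideals.sharp E ↔
      ∃ a ∈ E, ∃ e ∈ E, ∃ b ∈ E, S.Idem e ∧ x ≤ S.mul (S.mul a (S.sharp e)) b := by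
  obtain ⟨k, hk⟩ : ∃ k, (Nat.card M).factorial = k + 1 :=
    ⟨_, (Nat.sub_add_cancel (Nat.factorial_pos _)).symm⟩
  -- Values of expressions stay in `E`, so all that surrounds one chosen occurrence of `ω♯` can be
  -- collected into a left and a right factor from `E`.
  have key : ∀ F : SharpExpr (E : Set M), S.exprValue (fun x : (E : Set M) => (x : M)) F ∈ E ∧
      (F.IsStrict → ∃ a ∈ E, ∃ e ∈ E, ∃ b ∈ E, S.Idem e ∧
        S.exprValue (fun x : (E : Set M) => (x : M)) F = S.mul (S.mul a (S.sharp e)) b) := by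
    intro F
    induction F with
    | letter a => exact ⟨a.2, fun h => h.elim⟩
    | mul F G ihF ihG =>
      refine ⟨hE.mul_mem ihF.1 ihG.1, ?_⟩
      rintro (h | h)
      · obtain ⟨a, ha, e, he, b, hb, hi, hx⟩ := ihF.2 h
        exact ⟨a, ha, e, he, _, hE.mul_mem hb ihG.1, hi, by
          rw [exprValue, hx, hS.mul_assoc]⟩
      · obtain ⟨a, ha, e, he, b, hb, hi, hx⟩ := ihG.2 h
        exact ⟨_, hE.mul_mem ihF.1 ha, e, he, b, hb, hi, by
          rw [exprValue, hx]; simp only [hS.mul_assoc]⟩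
    | omegaSharp F ih =>
      have hi := hS.idem_pow_factorial (S.exprValue (fun x : (E : Set M) => (x : M)) F)
      have hm : S.pow (S.exprValue (fun x : (E : Set M) => (x : M)) F) (Nat.card M).factorial
          ∈ E := hk ▸ hS.pow_mem hE ih.1 k
      exact ⟨E.lower (hS.sharp_le _ hi) hm, fun _ => ⟨_, hm, _, hm, _, hm, hi, by
        rw [hS.mul_sharp hi, hS.sharp_mul hi]; rfl⟩⟩
  simp only [ideals, mem_lowerClosure, strictValues, Set.mem_ofPred_eq]
  constructor
  · rintro ⟨y, ⟨F, hF, rfl⟩, hx⟩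
    obtain ⟨a, ha, e, he, b, hb, hi, hy⟩ := (key F).2 hF
    exact ⟨a, ha, e, he, b, hb, hi, hy ▸ hx⟩
  · rintro ⟨a, ha, e, he, b, hb, hi, hx⟩
    refine ⟨_, ⟨.mul (.mul (.letter ⟨a, ha⟩) (.omegaSharp (.letter ⟨e, he⟩))) (.letter ⟨b, hb⟩),
      .inl (.inr trivial), rfl⟩, ?_⟩
    simp only [exprValue]
    rwa [hk, hS.pow_of_idem hi]

theorem ideals_sharp_le (hS : S.IsStabilisationMonoid) {E : LowerSet M}
    (hE : S.ideals.Idem E) : S.ideals.sharp E ≤ E := by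
  intro x hx
  obtain ⟨a, ha, e, he, b, hb, hi, hx⟩ := (hS.mem_ideals_sharp hE).1 hx
  exact E.lower hx (hE.mul_mem (hE.mul_mem ha (E.lower (hS.sharp_le e hi) he)) hb)

theorem sharp_mem_ideals_sharp (hS : S.IsStabilisationMonoid) {E : LowerSet M}
    (hE : S.ideals.Idem E) {e : M} (he : e ∈ E) (hi : S.Idem e) :
    S.sharp e ∈ S.ideals.sharp E :=
  (hS.mem_ideals_sharp hE).2 ⟨e, he, e, he, e, he, hi, by rw [hS.mul_sharp hi, hS.sharp_mul hi]⟩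

theorem mul_mem_ideals_sharp (hS : S.IsStabilisationMonoid) {E : LowerSet M}
    (hE : S.ideals.Idem E) {a x : M} (ha : a ∈ E) (hx : x ∈ S.ideals.sharp E) :
    S.mul a x ∈ S.ideals.sharp E := by
  obtain ⟨c, hc, e, he, b, hb, hi, hx⟩ := (hS.mem_ideals_sharp hE).1 hx
  refine (hS.mem_ideals_sharp hE).2 ⟨_, hE.mul_mem ha hc, e, he, b, hb, hi, ?_⟩
  simpa only [hS.mul_assoc] using hS.mul_le_mul _ _ _ _ (le_refl a) hx

theorem mem_ideals_sharp_mul (hS : S.IsStabilisationMonoid) {E : LowerSet M}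
    (hE : S.ideals.Idem E) {a x : M} (ha : a ∈ E) (hx : x ∈ S.ideals.sharp E) :
    S.mul x a ∈ S.ideals.sharp E := by
  obtain ⟨c, hc, e, he, b, hb, hi, hx⟩ := (hS.mem_ideals_sharp hE).1 hx
  refine (hS.mem_ideals_sharp hE).2 ⟨c, hc, e, he, _, hE.mul_mem hb ha, hi, ?_⟩
  simpa only [hS.mul_assoc] using hS.mul_le_mul _ _ _ _ hx (le_refl a)

/-- Since `e♯` is idempotent, `a * e♯ * b` splits as `(a * e♯) * (e♯ * b)`, with both factors in
`E♯`. Conversely, `E♯ ⊆ E` and `E♯` absorbs multiplication by `E`. -/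
theorem ideals_sharp_idem (hS : S.IsStabilisationMonoid) {E : LowerSet M}
    (hE : S.ideals.Idem E) : S.ideals.Idem (S.ideals.sharp E) := by
  refine le_antisymm (fun x hx => ?_) fun x hx => ?_
  · obtain ⟨p, hp, q, hq, hx⟩ := mem_ideals_mul.1 hx
    exact (S.ideals.sharp E).lower hx (hS.mul_mem_ideals_sharp hE (hS.ideals_sharp_le hE hp) hq)
  · obtain ⟨a, ha, e, he, b, hb, hi, hx⟩ := (hS.mem_ideals_sharp hE).1 hx
    have h := hS.sharp_mem_ideals_sharp hE he hi
    refine mem_ideals_mul.2 ⟨_, hS.mul_mem_ideals_sharp hE ha h, _,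
      hS.mem_ideals_sharp_mul hE hb h, ?_⟩
    have : S.mul (S.sharp e) (S.mul (S.sharp e) b) = S.mul (S.sharp e) b := by
      rw [← hS.mul_assoc, hS.sharp_idem e hi]
    rwa [hS.mul_assoc, this, ← hS.mul_assoc]

theorem ideals_sharp_mono (hS : S.IsStabilisationMonoid) {E F : LowerSet M}
    (hE : S.ideals.Idem E) (hF : S.ideals.Idem F) (h : E ≤ F) :
    S.ideals.sharp E ≤ S.ideals.sharp F := by
  intro x hx
  obtain ⟨a, ha, e, he, b, hb, hi, hx⟩ := (hS.mem_ideals_sharp hE).1 hx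
  exact (hS.mem_ideals_sharp hF).2 ⟨a, h ha, e, h he, b, h hb, hi, hx⟩

/-- The stabilisation of an idempotent below `p * q` is bounded by a conjugate of that of an
idempotent power of `q * p`. -/
theorem sharp_le_conj (hS : S.IsStabilisationMonoid) {e p q : M} (he : S.Idem e)
    (h : e ≤ S.mul p q) : ∃ k, S.Idem (S.pow (S.mul q p) (k + 1)) ∧
      S.sharp e ≤ S.mul (S.mul (S.mul p (S.sharp (S.pow (S.mul q p) (k + 1))))
        (S.pow (S.mul q p) k)) q := by
  obtain ⟨k, hk⟩ : ∃ k, (Nat.card M).factorial = k + 1 :=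
    ⟨_, (Nat.sub_add_cancel (Nat.factorial_pos _)).symm⟩
  have h1 : ∀ k, S.pow (S.mul p q) (k + 1) = S.mul p (S.mul (S.pow (S.mul q p) k) q) := by
    intro k
    induction k with
    | zero => simp only [pow, hS.one_mul]
    | succ k ih => rw [pow, ih]; simp only [pow, hS.mul_assoc]
  have h2 : S.pow (S.mul q p) (k + 1) = S.mul (S.mul (S.pow (S.mul q p) k) q) p := by
    simp only [pow, hS.mul_assoc]
  have hi1 := hS.idem_pow_factorial (S.mul p q)
  have hi2 := hS.idem_pow_factorial (S.mul q p)
  rw [hk] at hi1 hi2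
  refine ⟨k, hi2, ?_⟩
  have h3 : e ≤ S.pow (S.mul p q) (k + 1) := by
    have := hS.pow_le_pow h (k + 1)
    rwa [hS.pow_of_idem he] at this
  refine (hS.sharp_mono _ _ he hi1 h3).trans (le_of_eq ?_)
  rw [h1 k] at hi1
  rw [h2] at hi2
  rw [h1 k, hS.sharp_consistent _ _ hi1 hi2, ← h2]
  simp only [hS.mul_assoc]

theorem ideals_mul_assoc (hS : S.IsStabilisationMonoid) (P Q R : LowerSet M) :
    S.ideals.mul (S.ideals.mul P Q) R = S.ideals.mul P (S.ideals.mul Q R) := by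
  ext x
  constructor
  · intro hx
    obtain ⟨y, hy, r, hr, hx⟩ := mem_ideals_mul.1 hx
    obtain ⟨p, hp, q, hq, hy⟩ := mem_ideals_mul.1 hy
    refine mem_ideals_mul.2 ⟨p, hp, _, mul_mem_ideals_mul hq hr, hx.trans ?_⟩
    rw [← hS.mul_assoc]
    exact hS.mul_le_mul _ _ _ _ hy le_rfl
  · intro hx
    obtain ⟨p, hp, y, hy, hx⟩ := mem_ideals_mul.1 hx
    obtain ⟨q, hq, r, hr, hy⟩ := mem_ideals_mul.1 hy
    refine mem_ideals_mul.2 ⟨_, mul_mem_ideals_mul hp hq, r, hr, hx.trans ?_⟩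
    rw [hS.mul_assoc]
    exact hS.mul_le_mul _ _ _ _ le_rfl hy

/-- An idempotent `e` in a product lies below some `p * q`. `sharp_le_conj` replaces its
stabilisation by that of a power of `q * p`, and the leftover factors regroup into elements of the
other product. Both inclusions use the same rewriting. -/
theorem ideals_sharp_consistent (hS : S.IsStabilisationMonoid) {P Q : LowerSet M}
    (hPQ : S.ideals.Idem (S.ideals.mul P Q)) (hQP : S.ideals.Idem (S.ideals.mul Q P)) :
    S.ideals.sharp (S.ideals.mul P Q) =
      S.ideals.mul (S.ideals.mul P (S.ideals.sharp (S.ideals.mul Q P))) Q := by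
  refine le_antisymm (fun x hx => ?_) fun x hx => ?_
  · obtain ⟨u, hu, e, he, v, hv, hi, hx⟩ := (hS.mem_ideals_sharp hPQ).1 hx
    obtain ⟨p, hp, q, hq, he⟩ := mem_ideals_mul.1 he
    obtain ⟨p₁, hp₁, q₁, hq₁, hu⟩ := mem_ideals_mul.1 hu
    obtain ⟨p₂, hp₂, q₂, hq₂, hv⟩ := mem_ideals_mul.1 hv
    obtain ⟨k, hk, hle⟩ := hS.sharp_le_conj hi he
    have hqp := mul_mem_ideals_mul (S := S) hq hp
    have hmem : S.mul (S.mul (S.mul q₁ p) (S.sharp (S.pow (S.mul q p) (k + 1))))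
        (S.mul (S.pow (S.mul q p) k) (S.mul q p₂)) ∈ S.ideals.sharp (S.ideals.mul Q P) :=
      (hS.mem_ideals_sharp hQP).2 ⟨_, mul_mem_ideals_mul hq₁ hp, _, hS.pow_mem hQP hqp k, _,
        hS.pow_mul_mem hQP hqp (mul_mem_ideals_mul hq hp₂) k, hk, le_rfl⟩
    refine mem_ideals_mul.2 ⟨_, mul_mem_ideals_mul hp₁ hmem, q₂, hq₂,
      (hx.trans (hS.mul_mul_le hu hle hv)).trans (le_of_eq ?_)⟩
    simp only [hS.mul_assoc]
  · obtain ⟨y, hy, q, hq, hx⟩ := mem_ideals_mul.1 hx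
    obtain ⟨p, hp, z, hz, hy⟩ := mem_ideals_mul.1 hy
    obtain ⟨u, hu, e, he, v, hv, hi, hz⟩ := (hS.mem_ideals_sharp hQP).1 hz
    obtain ⟨q', hq', p', hp', he⟩ := mem_ideals_mul.1 he
    obtain ⟨q₁, hq₁, p₁, hp₁, hu⟩ := mem_ideals_mul.1 hu
    obtain ⟨q₂, hq₂, p₂, hp₂, hv⟩ := mem_ideals_mul.1 hv
    obtain ⟨k, hk, hle⟩ := hS.sharp_le_conj hi he
    have hpq := mul_mem_ideals_mul (S := S) hp' hq'
    refine (hS.mem_ideals_sharp hPQ).2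
      ⟨_, hPQ.mul_mem (mul_mem_ideals_mul hp hq₁) (mul_mem_ideals_mul hp₁ hq'), _,
        hS.pow_mem hPQ hpq k, _, hS.pow_mul_mem hPQ hpq
          (hPQ.mul_mem (mul_mem_ideals_mul hp' hq₂) (mul_mem_ideals_mul hp₂ hq)) k, hk, ?_⟩
    refine (hx.trans (hS.mul_le_mul _ _ _ _ (hy.trans (hS.mul_le_mul _ _ _ _ le_rfl
      (hz.trans (hS.mul_mul_le hu hle hv)))) le_rfl)).trans (le_of_eq ?_)
    simp only [hS.mul_assoc]

/-- The ideals of a stabilisation monoid form a stabilisation monoid. -/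
theorem ideals (hS : S.IsStabilisationMonoid) : S.ideals.IsStabilisationMonoid where
  finite :=
    have := hS.finite
    Finite.of_injective (fun L : LowerSet M => (L : Set M)) SetLike.coe_injective
  mul_assoc := hS.ideals_mul_assoc
  one_mul P := by
    refine le_antisymm (fun x hx => ?_) fun x hx => ?_
    · obtain ⟨y, hy, p, hp, hx⟩ := mem_ideals_mul.1 hx
      refine P.lower (hx.trans (hS.mul_le_mul _ _ _ _ hy le_rfl)) ?_
      rwa [hS.one_mul]
    · exact mem_ideals_mul.2 ⟨S.one, le_refl S.one, x, hx, (hS.one_mul x).ge⟩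
  mul_one P := by
    refine le_antisymm (fun x hx => ?_) fun x hx => ?_
    · obtain ⟨p, hp, y, hy, hx⟩ := mem_ideals_mul.1 hx
      refine P.lower (hx.trans (hS.mul_le_mul _ _ _ _ le_rfl hy)) ?_
      rwa [hS.mul_one]
    · exact mem_ideals_mul.2 ⟨x, hx, S.one, le_refl S.one, (hS.mul_one x).ge⟩
  mul_le_mul P P' Q Q' hP hQ x hx := by
    obtain ⟨p, hp, q, hq, hx⟩ := mem_ideals_mul.1 hx
    exact mem_ideals_mul.2 ⟨p, hP hp, q, hQ hq, hx⟩
  sharp_idem E hE := hS.ideals_sharp_idem hE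
  sharp_mono E F hE hF h := hS.ideals_sharp_mono hE hF h
  sharp_consistent P Q hPQ hQP := hS.ideals_sharp_consistent hPQ hQP
  sharp_le E hE := hS.ideals_sharp_le hE
  sharp_sharp E hE := by
    have hE' := hS.ideals_sharp_idem hE
    refine le_antisymm (hS.ideals_sharp_le hE') fun x hx => ?_
    obtain ⟨a, ha, e, he, b, hb, hi, hx⟩ := (hS.mem_ideals_sharp hE).1 hx
    have h := hS.sharp_mem_ideals_sharp hE he hi
    -- The witness is `a * e♯ * b = (a * e♯) * (e♯)♯ * (e♯ * b)`, whose outer factors and middle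
    -- idempotent are all in `E♯`.
    refine (hS.mem_ideals_sharp hE').2 ⟨_, hS.mul_mem_ideals_sharp hE ha h, _, h, _,
      hS.mem_ideals_sharp_mul hE hb h, hS.sharp_idem e hi, ?_⟩
    have hs : ∀ y, S.mul (S.sharp e) (S.mul (S.sharp e) y) = S.mul (S.sharp e) y := fun y => by
      rw [← hS.mul_assoc, hS.sharp_idem e hi]
    rw [hS.sharp_sharp e hi]
    simp only [hS.mul_assoc, hs] at hx ⊢
    exact hx
  sharp_one := by
    have hone : S.Idem S.one := hS.one_mul _
    have hE : S.ideals.Idem S.ideals.one := by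
      refine le_antisymm (fun x hx => ?_) fun x hx => ?_
      · obtain ⟨y, hy, z, hz, hx⟩ := mem_ideals_mul.1 hx
        exact (hx.trans (hS.mul_le_mul _ _ _ _ hy hz)).trans hone.le
      · exact mem_ideals_mul.2 ⟨S.one, le_refl S.one, x, hx, (hS.one_mul x).ge⟩
    refine le_antisymm (hS.ideals_sharp_le hE) fun x hx => ?_
    have := hS.sharp_mem_ideals_sharp hE (le_refl S.one) hone
    rw [hS.sharp_one] at this
    exact (S.ideals.sharp S.ideals.one).lower hx this

end IsStabilisationMonoid

end StabStructure

/-! ## Recognition of inf-projections -/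

namespace StabStructure

section

variable {M : Type u} {S : StabStructure M} {n p : ℕ}

theorem HasComp.le_length_flatten {r : M → M → Prop} {ys : List M} {ws : List (List M)}
    (h : List.Forall₂ (fun y w => S.HasComp r n p y w) ys ws) :
    ys.length ≤ ws.flatten.length := by
  induction h with
  | nil => simp
  | cons h _ ih =>
    have := List.length_pos_of_ne_nil h.ne_nil
    simp only [List.length_cons, List.flatten_cons, List.length_append]
    omega

theorem DeleteOnes.refl (a : List M) : S.DeleteOnes a a := by
  induction a with
  | nil => exact .nil
  | cons x a ih => exact .keep _ _ _ ih

theorem ExistsComputation.imp {r r' : M → M → Prop} (hr : ∀ x y, r x y → r' x y) {b : List M}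
    {X : Set M} (hc : S.ExistsComputation r n p b X) : S.ExistsComputation r' n p b X := by
  rw [existsComputation_iff] at hc ⊢
  obtain ⟨x, hx, a, ha, hb⟩ := hc
  exact ⟨x, hx, a, ha.imp hr, hb⟩

end

section

variable {M : Type u} [Monoid M] {S : StabStructure M} {n p : ℕ} {x : M} {u : List M}

/-- Computations for words of length at most `n` contain no stabilisation nodes. -/
theorem SharpLaws.value_eq_prod (hS : S.SharpLaws) (h : S.ExactComp n p x u) :
    u.length ≤ n → x = u.prod := by
  refine HasComp.induction (Q := fun p x u => u.length ≤ n → x = u.prod) ?_ ?_ h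
  · rintro p x a rfl -
    simp
  · intro p x ys ws hw hx hn
    have hlen := HasComp.le_length_flatten (hw.imp fun _ _ h => h.1)
    have hys : ws.map List.prod = ys := by
      have hn' : ∀ w ∈ ws, w.length ≤ n := fun w hw' =>
        (List.Sublist.length_le (List.sublist_flatten_of_mem hw')).trans hn
      clear hx hn hlen
      induction hw with
      | nil => rfl
      | cons h _ ih =>
        rw [List.map_cons, ih fun w hw => hn' w (by simp [hw]), ← h.2 (hn' _ (by simp))]
    rw [List.prod_flatten, hys]
    rcases hx with ⟨y₁, y₂, rfl, rfl⟩ | ⟨h1, h2, e, he, hy, rfl⟩ | ⟨h1, e, he, hy, rfl⟩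
    · simp [hS.mul_eq]
    · have he' : x * x = x := (hS.mul_eq x x).symm.trans he
      have := List.prod_flatten_of_idem (ws := ys.map fun y => [y]) he' (by
        rintro h
        rw [List.map_eq_nil_iff] at h
        simp [h] at h1) (by
        intro z hz
        obtain ⟨y, hy', rfl⟩ := List.mem_map.1 hz
        simpa using hy y hy')
      have hid : (List.prod ∘ fun y : M => [y]) = id := by funext y; simp
      rw [List.prod_flatten, List.map_map, hid, List.map_id] at this
      exact this.symm
    · omega

end

section

variable {M : Type u} [PartialOrder M] {S : StabStructure M} {n p : ℕ}

theorem _root_.List.forall₂_of_forall_eq {α : Type u} {β : Type v} {R : α → β → Prop} {e : α}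
    {as : List α} {bs : List β} (hl : as.length = bs.length) (ha : ∀ a ∈ as, a = e)
    (hb : ∀ b ∈ bs, R e b) : List.Forall₂ R as bs := by
  rw [List.forall₂_iff_get]
  refine ⟨hl, fun i h1 h2 => ?_⟩
  have := ha _ (List.getElem_mem h1)
  simpa [this] using hb _ (List.getElem_mem h2)

namespace IsStabilisationMonoid

/-- The elements of an idempotent ideal are bounded by products of any number of elements. -/
theorem exists_comp_of_idem (hS : S.IsStabilisationMonoid) {E : LowerSet M}
    (hE : S.ideals.Idem E) {x : M} (hx : x ∈ E) {N k : ℕ} (hk : 1 ≤ k) (hkN : k ≤ N) :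
    ∃ b : List M, b.length = k ∧ (∀ y ∈ b, y ∈ E) ∧
      S.HasComp (fun y z => y ≤ z) N (3 * Nat.card M) x b := by
  let _ := hS.toMonoid
  obtain ⟨b, hb, hbE, hxb⟩ : ∃ b : List M, b.length = k ∧ (∀ y ∈ b, y ∈ E) ∧ x ≤ b.prod := by
    clear hkN
    induction k, hk using Nat.le_induction generalizing x with
    | base => exact ⟨[x], rfl, by simpa, by simp⟩
    | succ k hk ih =>
      obtain ⟨c, hc, d, hd, hcd⟩ := hE.exists_le_mul hx
      obtain ⟨b, hb, hbE, hdb⟩ := ih hd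
      refine ⟨c :: b, by simp [hb], ?_, ?_⟩
      · intro y hy
        rcases List.mem_cons.1 hy with rfl | hy
        · exact hc
        · exact hbE y hy
      · rw [List.prod_cons]
        exact hcd.trans (hS.mul_le_mul _ _ _ _ le_rfl hdb)
  have hne : b ≠ [] := by
    rintro rfl
    simp at hb
    omega
  obtain ⟨v, hv⟩ := hS.exists_exactComp N hne
  -- The word has length `k ≤ N`, too short for a stabilisation node, so the computed value is the
  -- plain product.
  have hvb := hS.sharpLaws.value_eq_prod hv (by omega)
  refine ⟨b, hb, hbE, HasComp.rel (hv.imp fun _ _ h => h.le) ?_⟩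
  rwa [hvb]

/-- With `x ≤ a * e♯ * c`, the word is `a`, then `k - 2` copies of `e`, then `c`; from `4 ≤ k` the
run has at least two members. Even a run within the threshold is usable, because an
under-computation may lower its value from `e` to `e♯`. -/
theorem exists_comp_of_sharp (hS : S.IsStabilisationMonoid) {E : LowerSet M}
    (hE : S.ideals.Idem E) {x : M} (hx : x ∈ S.ideals.sharp E) {N k : ℕ} (hk : 4 ≤ k) :
    ∃ b : List M, b.length = k ∧ (∀ y ∈ b, y ∈ E) ∧
      S.HasComp (fun y z => y ≤ z) N 3 x b := by
  obtain ⟨a, ha, e, he, c, hc, hi, hx⟩ := (hS.mem_ideals_sharp hE).1 hx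
  have hrun : S.HasComp (fun y z => y ≤ z) N 1 (S.sharp e) (List.replicate (k - 2) e) := by
    have := HasComp.node (S := S) (r := fun y z => y ≤ z) (n := N) (p := 0) (x := S.sharp e)
      (ys := List.replicate (k - 2) e) (ws := List.replicate (k - 2) [e])
      (List.forall₂_of_forall_eq (e := e) (by simp) (fun a ha => List.eq_of_mem_replicate ha)
        (fun b hb => by
          rw [List.eq_of_mem_replicate hb]
          exact HasComp.leaf le_rfl)) (by
        by_cases hkN : k - 2 ≤ N
        · exact .inr (.inl ⟨by simp; omega, by simpa using hkN, e, hi,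
            fun y hy => List.eq_of_mem_replicate hy, hS.sharp_le e hi⟩)
        · exact .inr (.inr ⟨by simp; omega, e, hi,
            fun y hy => List.eq_of_mem_replicate hy, le_rfl⟩))
    simpa using this
  have h1 := HasComp.binary (x := S.mul a (S.sharp e)) (HasComp.leaf (x := a) le_rfl) hrun le_rfl
  have h2 := HasComp.binary h1 (HasComp.leaf (x := c) le_rfl) hx
  refine ⟨_, ?_, ?_, h2⟩
  · simp; omega
  · intro y hy
    simp only [List.mem_append, List.mem_singleton, List.mem_replicate] at hy
    rcases hy with (rfl | ⟨-, rfl⟩) | rfl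
    · exact ha
    · exact he
    · exact hc

/-- From an under-computation over the ideals to an under-computation over the monoid. -/
theorem exists_word_of_ideals (hS : S.IsStabilisationMonoid) {N : ℕ} (hN : n ≤ N) (h3 : 3 ≤ N)
    {J : LowerSet M} {a : List (LowerSet M)}
    (h : S.ideals.HasComp (fun y z => y ≤ z) n p J a) :
    ∀ x ∈ J, ∃ b, List.Forall₂ (fun (P : LowerSet M) y => y ∈ P) a b ∧
      S.HasComp (fun y z => y ≤ z) N ((3 * Nat.card M + 3) * p) x b := by
  refine HasComp.induction (Q := fun p J a => ∀ x ∈ J, ∃ b,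
    List.Forall₂ (fun (P : LowerSet M) y => y ∈ P) a b ∧
      S.HasComp (fun y z => y ≤ z) N ((3 * Nat.card M + 3) * p) x b) ?_ ?_ h
  · intro p J P hJ x hx
    exact ⟨[x], by simpa using hJ hx, HasComp.leaf le_rfl⟩
  · intro p J ys ws hw hJ x hx
    obtain ⟨b, hb, hxb⟩ : ∃ b, List.Forall₂ (fun (P : LowerSet M) y => y ∈ P) ys b ∧
        S.HasComp (fun y z => y ≤ z) N (3 * Nat.card M + 3) x b := by
      rcases hJ with ⟨P, Q, rfl, hJ⟩ | ⟨h1, h2, E, hE, hys, hJ⟩ | ⟨h1, E, hE, hys, hJ⟩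
      · obtain ⟨y, hy, z, hz, hle⟩ := mem_ideals_mul.1 (hJ hx)
        exact ⟨[y, z], by simp [hy, hz], (HasComp.binary (p := 0) (HasComp.leaf (x := y) le_rfl)
          (HasComp.leaf (x := z) le_rfl) hle).mono (by omega)⟩
      · obtain ⟨b, h4, h5, h6⟩ := hS.exists_comp_of_idem hE (hJ hx) (k := ys.length) (N := N)
          (by omega) (by omega)
        exact ⟨b, List.forall₂_of_forall_eq h4.symm hys h5, h6.mono (by omega)⟩
      -- A node that stabilises for `n` may have at most `N` children; `E♯ ⊆ E` lets it be treated
      -- as an idempotent node. Otherwise `3 ≤ N` provides the four children needed for a run.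
      · by_cases hkN : ys.length ≤ N
        · obtain ⟨b, h4, h5, h6⟩ := hS.exists_comp_of_idem hE
            (hS.ideals_sharp_le hE (hJ hx)) (k := ys.length) (N := N) (by omega) hkN
          exact ⟨b, List.forall₂_of_forall_eq h4.symm hys h5, h6.mono (by omega)⟩
        · obtain ⟨b, h4, h5, h6⟩ := hS.exists_comp_of_sharp hE (hJ hx) (k := ys.length) (N := N)
            (by omega)
          exact ⟨b, List.forall₂_of_forall_eq h4.symm hys h5, h6.mono (by omega)⟩
    obtain ⟨bs, hbs, hbw⟩ : ∃ bs, List.Forall₂ (S.HasComp (fun y z => y ≤ z) N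
        ((3 * Nat.card M + 3) * p)) b bs ∧
        List.Forall₂ (List.Forall₂ (fun (P : LowerSet M) y => y ∈ P)) ws bs := by
      clear hxb hJ
      induction hw generalizing b with
      | nil =>
        cases hb
        exact ⟨[], .nil, .nil⟩
      | cons h _ ih =>
        cases hb with
        | cons hy hb =>
          obtain ⟨bs, h1, h2⟩ := ih _ hb
          obtain ⟨c, h3, h4⟩ := h.2 _ hy
          exact ⟨c :: bs, .cons h4 h1, .cons h3 h2⟩
    refine ⟨bs.flatten, List.rel_flatten hbw, ?_⟩
    rw [Nat.mul_add, Nat.mul_one, Nat.add_comm]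
    exact hxb.subst hbs

/-- A stabilisation node has its value in `E♯`, and `E♯` absorbs multiplication by `E`, so this
passes up to the root. Without such a node each node has at most `max 2 n ≤ n + 2` children, which
bounds the number of leaves. -/
theorem mem_sharp_or_length_le (hS : S.IsStabilisationMonoid) {E : LowerSet M}
    (hE : S.ideals.Idem E) {x : M} {u : List M} (h : S.HasComp (fun y z => y = z) n p x u) :
    (∀ y ∈ u, y ∈ E) → x ∈ E ∧ (x ∈ S.ideals.sharp E ∨ u.length ≤ (n + 2) ^ p) := by
  refine HasComp.induction (Q := fun p x u => (∀ y ∈ u, y ∈ E) →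
    x ∈ E ∧ (x ∈ S.ideals.sharp E ∨ u.length ≤ (n + 2) ^ p)) ?_ ?_ h
  · rintro p x a rfl hu
    exact ⟨hu _ (by simp), .inr (by simpa using Nat.one_le_pow _ _ (by omega))⟩
  · intro p x ys ws hw hx hu
    have hys : ∀ y ∈ ys, y ∈ E := by
      intro y hy
      rw [List.forall₂_iff_get] at hw
      obtain ⟨i, hi, rfl⟩ := List.mem_iff_getElem.1 hy
      have hi' : i < ws.length := hw.1 ▸ hi
      exact ((hw.2 i hi hi').2 fun z hz =>
        hu z (List.mem_flatten.2 ⟨_, List.getElem_mem hi', hz⟩)).1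
    have hlen : (∃ y ∈ ys, y ∈ S.ideals.sharp E) ∨
        ws.flatten.length ≤ ys.length * (n + 2) ^ p := by
      clear hx hys
      induction hw with
      | nil => right; simp
      | @cons y w ys ws h _ ih =>
        rcases (h.2 fun z hz => hu z (by simp [hz])).2 with h1 | h1
        · exact .inl ⟨y, by simp, h1⟩
        · rcases ih fun z hz => hu z (by
            rw [List.flatten_cons]; exact List.mem_append_right _ hz) with ⟨z, hz, h2⟩ | h2
          · exact .inl ⟨z, by simp [hz], h2⟩
          · right
            rw [List.flatten_cons, List.length_append, List.length_cons, Nat.add_mul, Nat.one_mul]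
            omega
    rcases hx with ⟨y₁, y₂, rfl, rfl⟩ | ⟨h1, h2, e, he, hy, rfl⟩ | ⟨h1, e, he, hy, rfl⟩
    · have hy₁ := hys y₁ (by simp)
      have hy₂ := hys y₂ (by simp)
      refine ⟨hE.mul_mem hy₁ hy₂, ?_⟩
      rcases hlen with ⟨z, hz, h⟩ | h
      · left
        simp only [List.mem_cons, List.not_mem_nil, or_false] at hz
        rcases hz with rfl | rfl
        · exact hS.mem_ideals_sharp_mul hE hy₂ h
        · exact hS.mul_mem_ideals_sharp hE hy₁ h
      · right
        refine h.trans ?_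
        rw [pow_succ', List.length_cons, List.length_singleton]
        exact Nat.mul_le_mul_right _ (by omega)
    · obtain ⟨z, hz⟩ := List.exists_mem_of_length_pos (l := ys) (by omega)
      refine ⟨hy z hz ▸ hys z hz, ?_⟩
      rcases hlen with ⟨z, hz, h⟩ | h
      · exact .inl (hy z hz ▸ h)
      · right
        refine h.trans ?_
        rw [pow_succ']
        exact Nat.mul_le_mul_right _ (by omega)
    · obtain ⟨z, hz⟩ := List.exists_mem_of_length_pos (l := ys) (by omega)
      have h := hS.sharp_mem_ideals_sharp hE (hy z hz ▸ hys z hz) he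
      exact ⟨hS.ideals_sharp_le hE h, .inl h⟩

theorem card_pos (hS : S.IsStabilisationMonoid) : 0 < Nat.card M :=
  have := hS.finite
  have : Nonempty M := ⟨S.one⟩
  Nat.card_pos

/-- From an over-computation over the ideals to computations over the monoid. -/
theorem exists_value_of_ideals (hS : S.IsStabilisationMonoid) {m : ℕ}
    (hn : (m + 2) ^ (3 * Nat.card M) ≤ n) {J : LowerSet M} {a : List (LowerSet M)}
    (h : S.ideals.HasComp (fun y z => y ≥ z) n p J a) :
    ∀ b, List.Forall₂ (fun (P : LowerSet M) y => y ∈ P) a b →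
      ∃ x ∈ J, S.HasComp (fun y z => y = z) m (3 * Nat.card M * p) x b := by
  refine HasComp.induction (Q := fun p J a =>
    ∀ b, List.Forall₂ (fun (P : LowerSet M) y => y ∈ P) a b →
      ∃ x ∈ J, S.HasComp (fun y z => y = z) m (3 * Nat.card M * p) x b) ?_ ?_ h
  · intro p J P hJ b hb
    cases hb with
    | cons hy hb =>
      cases hb
      exact ⟨_, hJ hy, HasComp.leaf rfl⟩
  · intro p J ys ws hw hJ b hb
    obtain ⟨bs, rfl, hbs⟩ := hb.exists_flatten
    obtain ⟨vs, hvs, hvb⟩ : ∃ vs, List.Forall₂ (fun (P : LowerSet M) y => y ∈ P) ys vs ∧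
        List.Forall₂ (S.HasComp (fun y z => y = z) m (3 * Nat.card M * p)) vs bs := by
      clear hJ hb
      induction hw generalizing bs with
      | nil =>
        cases hbs
        exact ⟨[], .nil, .nil⟩
      | cons h _ ih =>
        cases hbs with
        | cons hy hb =>
          obtain ⟨vs, h1, h2⟩ := ih _ hb
          obtain ⟨x, h3, h4⟩ := h.2 _ hy
          exact ⟨x :: vs, .cons h3 h1, .cons h4 h2⟩
    have hlen := hvs.length_eq
    have mem_of : ∀ E, (∀ P ∈ ys, P = E) → ∀ y ∈ vs, y ∈ E := by
      intro E hE y hy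
      rw [List.forall₂_iff_get] at hvs
      obtain ⟨i, hi, rfl⟩ := List.mem_iff_getElem.1 hy
      have hi' : i < ys.length := hlen ▸ hi
      have := hvs.2 i hi' hi
      rw [hE _ (List.get_mem ys ⟨i, hi'⟩)] at this
      exact this
    obtain ⟨x, hx, hxv⟩ : ∃ x ∈ J, S.HasComp (fun y z => y = z) m (3 * Nat.card M) x vs := by
      rcases hJ with ⟨P, Q, rfl, hJ⟩ | ⟨h1, h2, E, hE, hys, hJ⟩ | ⟨h1, E, hE, hys, hJ⟩
      · match vs, hvs with
        | [y, z], .cons hy (.cons hz .nil) =>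
          exact ⟨_, hJ (mul_mem_ideals_mul hy hz),
            (HasComp.binary (p := 0) (HasComp.leaf (x := y) rfl) (HasComp.leaf (x := z) rfl)
              rfl).mono (by have := hS.card_pos; omega)⟩
      · obtain ⟨v, hv⟩ := hS.exists_exactComp m (u := vs) (by
          rintro rfl
          rw [List.length_nil] at hlen
          omega)
        exact ⟨v, hJ (hS.mem_sharp_or_length_le hE hv (mem_of E hys)).1, hv⟩
      · obtain ⟨v, hv⟩ := hS.exists_exactComp m (u := vs) (by
          rintro rfl
          rw [List.length_nil] at hlen
          omega)
        -- The node has more than `n ≥ (m + 2) ^ (3 * Nat.card M)` children, which rules out the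
        -- length alternative.
        refine ⟨v, hJ ((hS.mem_sharp_or_length_le hE hv (mem_of E hys)).2.resolve_right ?_), hv⟩
        omega
    refine ⟨x, hx, ?_⟩
    rw [Nat.mul_add, Nat.mul_one, Nat.add_comm]
    exact hxv.subst hvb

end IsStabilisationMonoid

/-! ### Lifting words and comparing the cost functions -/

variable {A : Type v} {B : Type w} {h : A → M} {z : A → B}

theorem mem_idealMap {b : B} {x : M} : x ∈ idealMap h z b ↔ ∃ a, z a = b ∧ x ≤ h a := by
  simp [idealMap, mem_lowerClosure]

/-- A selection from the ideals is only below the generators: a kept entry is below some `h s`, a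
deleted one below the unit. Raising each entry to such a bound yields a genuine preimage word with
units inserted; under-computations tolerate the change. -/
theorem DeleteOnes.exists_lift {a : List (LowerSet M)} {c : List (LowerSet M)}
    (hd : S.ideals.DeleteOnes a c) : ∀ {y : List B} {b : List M}, c = y.map (idealMap h z) →
    List.Forall₂ (fun (P : LowerSet M) y => y ∈ P) a b →
    ∃ (u : List A) (b' : List M), u.map z = y ∧ S.DeleteOnes b' (u.map h) ∧
      List.Forall₂ (· ≤ ·) b b' := by
  induction hd with
  | nil =>
    intro y b hy hb
    cases hb
    obtain rfl : y = [] := by simpa using hy.symm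
    exact ⟨[], [], rfl, .nil, .nil⟩
  | keep P a c _ ih =>
    intro y b hy hb
    cases hb with
    | cons hx hb =>
      obtain ⟨t, y, rfl, rfl, rfl⟩ := List.map_eq_cons_iff.1 hy.symm
      obtain ⟨u, b', rfl, h2, h3⟩ := ih rfl hb
      obtain ⟨s, rfl, hs⟩ := mem_idealMap.1 hx
      exact ⟨s :: u, h s :: b', rfl, .keep _ _ _ h2, .cons hs h3⟩
  | delete a c _ ih =>
    intro y b hy hb
    cases hb with
    | cons hx hb =>
      obtain ⟨u, b', h1, h2, h3⟩ := ih hy hb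
      exact ⟨u, S.one :: b', h1, .delete _ _ h2, .cons hx h3⟩

/-- Here the preimage word is prescribed, so the selection consists of the generators `h s`
themselves and of `1` at the deleted places. -/
theorem DeleteOnes.exists_mem {a : List (LowerSet M)} {c : List (LowerSet M)}
    (hd : S.ideals.DeleteOnes a c) : ∀ {u : List A}, c = (u.map z).map (idealMap h z) →
    ∃ b : List M, S.DeleteOnes b (u.map h) ∧
      List.Forall₂ (fun (P : LowerSet M) y => y ∈ P) a b := by
  induction hd with
  | nil =>
    intro u hu
    obtain rfl : u = [] := by simpa using hu.symm
    exact ⟨[], .nil, .nil⟩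
  | keep P a c _ ih =>
    intro u hu
    cases u with
    | nil => simp at hu
    | cons s u =>
      obtain ⟨rfl, rfl⟩ := List.cons.inj hu
      obtain ⟨b, h1, h2⟩ := ih rfl
      exact ⟨h s :: b, .keep _ _ _ h1, .cons (mem_idealMap.2 ⟨s, rfl, le_rfl⟩) h2⟩
  | delete a c _ ih =>
    intro u hu
    obtain ⟨b, h1, h2⟩ := ih hu
    exact ⟨S.one :: b, .delete _ _ h1, .cons (le_refl S.one) h2⟩

section Semantics

variable (S) (h) (I : LowerSet M) (p) (x : List A)

theorem semMinusMinus_le_semMinus : S.semMinusMinus h I p x ≤ S.semMinus h I p x :=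
  le_iInf₂ fun n hn => iInf₂_le n (hn.imp fun _ _ h => h.le)

theorem semPlus_le_semPlusPlus : S.semPlus h I p x ≤ S.semPlusPlus h I p x :=
  iSup₂_le fun n hn => le_iSup₂ (f := fun (n : ℕ) (_ : S.ExistsComputation _ n p (x.map h) I) =>
    ((n + 1 : ℕ) : ℕ∞)) n (hn.imp fun _ _ h => h.ge)

-- For each `n` some exact computation of height at most `3|M|` exists. Its value is either in `I`,
-- giving `n + 1 ≤` the supremum, or outside, giving the infimum `≤ n`; this is why the suprema
-- count `n + 1`.
variable {S} in
theorem IsStabilisationMonoid.semMinus_le_semPlus (hS : S.IsStabilisationMonoid)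
    (hp : 3 * Nat.card M ≤ p) : S.semMinus h I p x ≤ S.semPlus h I p x := by
  refine ENat.forall_natCast_le_iff_le.1 fun n hn => ?_
  cases n with
  | zero => simp
  | succ n =>
    -- A leading unit makes the word non-empty even when `x` is empty.
    have hdel : S.DeleteOnes (S.one :: x.map h) (x.map h) := .delete _ _ (.refl _)
    obtain ⟨v, hv⟩ := hS.exists_exactComp n (u := S.one :: x.map h) (by simp)
    by_cases hvI : v ∈ I
    · exact le_iSup₂ (f := fun (n : ℕ) (_ : S.ExistsComputation _ n p (x.map h) I) =>
        ((n + 1 : ℕ) : ℕ∞)) n (existsComputation_iff.2 ⟨v, hvI, _, hv.mono hp, hdel⟩)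
    · have : S.semMinus h I p x ≤ n :=
        iInf₂_le n (existsComputation_iff.2 ⟨v, hvI, _, hv.mono hp, hdel⟩)
      have := hn.trans this
      norm_cast at this
      omega

end Semantics

theorem _root_.CostEquiv.of_dominatedBy {E : Type u} {f g : E → ℕ∞} {α β : ℕ → ℕ}
    (hα : IsCorrection α) (hβ : IsCorrection β) (h₁ : DominatedBy α f g)
    (h₂ : DominatedBy β g f) : CostEquiv f g := by
  have mono : ∀ {α β : ℕ → ℕ} (x : ℕ∞), (∀ n, α n ≤ β n) → ENat.map α x ≤ ENat.map β x := by
    intro α β x hle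
    cases x with
    | top => exact le_rfl
    | coe n => exact WithTop.coe_le_coe.2 (hle n)
  refine ⟨fun n => max (α n) (β n), ⟨fun m n hmn => max_le_max (hα.1 hmn) (hβ.1 hmn),
    fun n => (hα.2 n).trans (le_max_left _ _)⟩, fun x => (h₁ x).trans (mono _ fun n => ?_),
    fun x => (h₂ x).trans (mono _ fun n => ?_)⟩
  · exact le_max_left _ _
  · exact le_max_right _ _

variable {I : LowerSet M} {f : List A → ℕ∞}

/-- A value ideal not contained in `I` has an element `x ∉ I`. `exists_word_of_ideals` realises `x`
over some preimage word, which bounds `f` there and hence the infimum. -/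
theorem IsStabilisationMonoid.infProjection_dominatedBy (hS : S.IsStabilisationMonoid)
    (hf : S.Recognises h I f) (p : ℕ) : ∃ α, IsCorrection α ∧ DominatedBy α (infProjection z f)
      (S.ideals.semMinusMinus (idealMap h z) (LowerSet.Iic I) p) := by
  obtain ⟨⟨α, hα, hle, -⟩, -⟩ :=
    hf (max (3 * Nat.card M) ((3 * Nat.card M + 3) * p)) (le_max_left _ _)
  -- The `3` is the least threshold allowed by `exists_word_of_ideals`.
  refine ⟨fun n => α (max n 3), ⟨fun m n hmn => hα.1 (max_le_max hmn le_rfl),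
    fun n => (le_max_left _ _).trans (hα.2 _)⟩, fun y => ?_⟩
  generalize hm : S.ideals.semMinusMinus (idealMap h z) (LowerSet.Iic I) p y = m
  cases m with
  | top => exact le_top
  | coe m =>
    have hlt : S.ideals.semMinusMinus (idealMap h z) (LowerSet.Iic I) p y < ((m + 1 : ℕ) : ℕ∞) := by
      rw [hm]; exact_mod_cast Nat.lt_succ_self m
    obtain ⟨n, hlt⟩ := iInf_lt_iff.1 hlt
    obtain ⟨hn, hnm⟩ := iInf_lt_iff.1 hlt
    have hnm' : n ≤ m := by
      have : n < m + 1 := by exact_mod_cast hnm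
      omega
    obtain ⟨J, hJ, a, ha, hay⟩ := existsComputation_iff.1 hn
    obtain ⟨x, hxJ, hxI⟩ : ∃ x ∈ J, x ∉ I := by
      by_contra! hcon
      exact hJ hcon
    obtain ⟨b, hab, hxb⟩ := hS.exists_word_of_ideals (N := max m 3)
      (hnm'.trans (le_max_left _ _)) (le_max_right _ _) ha x hxJ
    obtain ⟨u, b', rfl, hbu, hbb⟩ := hay.exists_lift rfl hab
    have hxb' : S.HasComp (fun y z => y ≤ z) (max m 3) ((3 * Nat.card M + 3) * p) x b' := by
      have hs : List.Forall₂ (S.HasComp (fun y z => y ≤ z) (max m 3) 0) b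
          (b'.map fun y => [y]) := by
        rw [List.forall₂_map_right_iff]
        exact hbb.imp fun _ _ h => HasComp.leaf h
      have := hxb.subst hs
      simpa [← List.flatMap_def] using this
    have h1 : S.semMinusMinus h I (max (3 * Nat.card M) ((3 * Nat.card M + 3) * p)) u ≤
        ((max m 3 : ℕ) : ℕ∞) :=
      iInf₂_le (max m 3) (existsComputation_iff.2 ⟨x, hxI, b', hxb'.mono (le_max_right _ _), hbu⟩)
    have h2 : infProjection z f (u.map z) ≤ f u :=
      iInf₂_le (f := fun (x : List A) (_ : x.map z = u.map z) => f x) u rfl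
    exact h2.trans ((hle u).trans (ENat.monotone_map_iff.2 hα.1 h1))

/-- Take a preimage `u` with `f u ≤ m`. An over-computation with a threshold of at least `(α m + 2)
^ (3 * Nat.card M)` would give an exact `α m`-computation over `u` with value in `I`, making the
supremum at `u` exceed `α m`. -/
theorem IsStabilisationMonoid.dominatedBy_infProjection (hS : S.IsStabilisationMonoid)
    (hf : S.Recognises h I f) (p : ℕ) : ∃ α, IsCorrection α ∧ DominatedBy α
      (S.ideals.semPlusPlus (idealMap h z) (LowerSet.Iic I) p) (infProjection z f) := by
  obtain ⟨-, -, ⟨α, hα, -, hle⟩, -⟩ :=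
    hf (max (3 * Nat.card M) (3 * Nat.card M * p)) (le_max_left _ _)
  have hpos : 3 * Nat.card M ≠ 0 := by have := hS.card_pos; omega
  refine ⟨fun n => (α n + 2) ^ (3 * Nat.card M),
    ⟨fun m n hmn => Nat.pow_le_pow_left (by have := hα.1 hmn; omega) _, fun n =>
      ((hα.2 n).trans (Nat.le_add_right _ 2)).trans (Nat.le_self_pow hpos _)⟩, fun y => ?_⟩
  generalize hm : infProjection z f y = m
  cases m with
  | top => exact le_top
  | coe m =>
    have hlt : infProjection z f y < ((m + 1 : ℕ) : ℕ∞) := by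
      rw [hm]; exact_mod_cast Nat.lt_succ_self m
    obtain ⟨u, hlt⟩ := iInf_lt_iff.1 hlt
    obtain ⟨rfl, hu⟩ := iInf_lt_iff.1 hlt
    have hum : f u ≤ m := by
      rw [Nat.cast_add, Nat.cast_one] at hu
      exact Order.le_of_lt_add_one hu
    refine iSup₂_le fun n hn => ?_
    obtain ⟨J, hJ, a, ha, hay⟩ := existsComputation_iff.1 hn
    obtain ⟨b, hbu, hab⟩ := hay.exists_mem rfl
    change ((n + 1 : ℕ) : ℕ∞) ≤ (((α m + 2) ^ (3 * Nat.card M) : ℕ) : ℕ∞)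
    rw [Nat.cast_le]
    by_contra! hcon
    obtain ⟨x, hx, hxb⟩ := hS.exists_value_of_ideals (m := α m) (by omega) ha b hab
    have h1 : ((α m + 1 : ℕ) : ℕ∞) ≤
        S.semPlus h I (max (3 * Nat.card M) (3 * Nat.card M * p)) u :=
      le_iSup₂ (f := fun (n : ℕ) (_ : S.ExistsComputation _ n _ (u.map h) I) =>
        ((n + 1 : ℕ) : ℕ∞)) (α m)
        (existsComputation_iff.2 ⟨x, hJ hx, b, hxb.mono (le_max_right _ _), hbu⟩)
    have h2 := h1.trans ((hle u).trans (ENat.monotone_map_iff.2 hα.1 hum))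
    have h3 : α m + 1 ≤ α m := WithTop.coe_le_coe.1 h2
    omega

/-- The ideals of a stabilisation monoid recognise the inf-projections. -/
theorem IsStabilisationMonoid.recognises_infProjection (hS : S.IsStabilisationMonoid)
    (hf : S.Recognises h I f) :
    S.ideals.Recognises (idealMap h z) (LowerSet.Iic I) (infProjection z f) := by
  intro p hp
  obtain ⟨α, hα, h₁⟩ := hS.infProjection_dominatedBy (z := z) hf p
  obtain ⟨β, hβ, h₂⟩ := hS.dominatedBy_infProjection (z := z) hf p
  have hmm := S.ideals.semMinusMinus_le_semMinus p (idealMap h z) (LowerSet.Iic I)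
  have hmp := fun x => hS.ideals.semMinus_le_semPlus p (idealMap h z) (LowerSet.Iic I) x hp
  have hpp := S.ideals.semPlus_le_semPlusPlus p (idealMap h z) (LowerSet.Iic I)
  -- Any function between the two extreme semantics is equivalent to the inf-projection, so both
  -- bounds are used for each of the four functions.
  have key : ∀ g : List B → ℕ∞,
      (∀ x, S.ideals.semMinusMinus (idealMap h z) (LowerSet.Iic I) p x ≤ g x) →
      (∀ x, g x ≤ S.ideals.semPlusPlus (idealMap h z) (LowerSet.Iic I) p x) →
      CostEquiv (infProjection z f) g := fun g hg₁ hg₂ =>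
    CostEquiv.of_dominatedBy hα hβ
      (fun x => (h₁ x).trans (ENat.monotone_map_iff.2 hα.1 (hg₁ x)))
      (fun x => (hg₂ x).trans (h₂ x))
  exact ⟨key _ (fun _ => le_rfl) (fun x => ((hmm x).trans (hmp x)).trans (hpp x)),
    key _ hmm (fun x => (hmp x).trans (hpp x)),
    key _ (fun x => (hmm x).trans (hmp x)) hpp,
    key _ (fun x => ((hmm x).trans (hmp x)).trans (hpp x)) (fun _ => le_rfl)⟩

end

end StabStructure

/-! ## The table of the monoid of ideals -/

namespace StabCode

/-- The entry of the multiplication table. -/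
def mulAt (c : StabCode) (i j : ℕ) : ℕ := (c.mul.getD i []).getD j 0

/-- The entry of the table of the order. -/
def leAt (c : StabCode) (i j : ℕ) : Bool := (c.le.getD i []).getD j false

/-- The entry of the stabilisation table. -/
def sharpAt (c : StabCode) (i : ℕ) : ℕ := c.sharp.getD i 0

/-- The number `P`, read as a bit mask, is a downward closed set. -/
def IsLowerMask (c : StabCode) (P : ℕ) : Prop :=
  ∀ x < c.size, ∀ y < c.size, c.leAt x y = true → P.testBit y = true → P.testBit x = true

open Classical in
/-- The list of all ideals, as bit masks. -/
noncomputable def lowers (c : StabCode) : List ℕ :=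
  (List.range (2 ^ c.size)).filter fun P => decide (c.IsLowerMask P)

open Classical in
/-- The position in the list of all ideals of the ideal described by `φ`. -/
noncomputable def index (c : StabCode) (φ : ℕ → Prop) : ℕ :=
  c.lowers.findIdx fun R => decide (∀ x < c.size, (R.testBit x = true ↔ φ x))

/-- Membership in the product of two ideals. -/
def MemMul (c : StabCode) (P Q x : ℕ) : Prop :=
  ∃ p < c.size, ∃ q < c.size, P.testBit p = true ∧ Q.testBit q = true ∧
    c.leAt x (c.mulAt p q) = true

/-- Membership in the stabilisation of an idempotent ideal. -/
def MemSharp (c : StabCode) (E x : ℕ) : Prop :=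
  ∃ a < c.size, ∃ e < c.size, ∃ b < c.size, E.testBit a = true ∧ E.testBit e = true ∧
    E.testBit b = true ∧ c.mulAt e e = e ∧
    c.leAt x (c.mulAt (c.mulAt a (c.sharpAt e)) b) = true

/-- Membership in the ideal of a letter. -/
def MemLetter (c : StabCode) (z : List ℕ) (b x : ℕ) : Prop :=
  ∃ i < z.length, z.getD i 0 = b ∧ c.leAt x (c.letters.getD i 0) = true

open Classical in
/-- The code of the monoid of ideals, the map of the letters, and the ideal. -/
noncomputable def idealsCode (t : StabCode × ℕ × List ℕ) : StabCode where
  size := t.1.lowers.length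
  one := t.1.index fun x => t.1.leAt x t.1.one = true
  mul := t.1.lowers.map fun P => t.1.lowers.map fun Q => t.1.index (t.1.MemMul P Q)
  sharp := t.1.lowers.map fun E => t.1.index (t.1.MemSharp E)
  le := t.1.lowers.map fun P => t.1.lowers.map fun Q =>
    decide (∀ x < t.1.size, P.testBit x = true → Q.testBit x = true)
  letters := (List.range t.2.1).map fun b => t.1.index (t.1.MemLetter t.2.2 b)
  ideal := t.1.lowers.map fun P =>
    decide (∀ x < t.1.size, P.testBit x = true → t.1.ideal.getD x false = true)

/-! ### Computability -/

section Computability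

variable {α : Type*} [Primcodable α] {c : α → StabCode}

theorem _root_.PrimrecPred.imp {p q : α → Prop} (hp : PrimrecPred p) (hq : PrimrecPred q) :
    PrimrecPred fun a => p a → q a :=
  (hp.not.or hq).of_eq fun _ => imp_iff_not_or.symm

theorem _root_.PrimrecPred.iff {p q : α → Prop} (hp : PrimrecPred p) (hq : PrimrecPred q) :
    PrimrecPred fun a => p a ↔ q a :=
  ((hp.imp hq).and (hq.imp hp)).of_eq fun _ => iff_iff_implies_and_implies.symm

theorem _root_.PrimrecPred.forall_lt_of {n : α → ℕ} {R : α → ℕ → Prop} (hn : Primrec n)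
    (hR : PrimrecPred fun q : α × ℕ => R q.1 q.2) : PrimrecPred fun a => ∀ x < n a, R a x := by
  have h : PrimrecRel fun (x : ℕ) (a : α) => R a x :=
    hR.comp (Primrec.pair Primrec.snd Primrec.fst)
  exact (h.forall_mem_list.comp (Primrec.list_range.comp hn) Primrec.id).of_eq (by simp)

theorem _root_.PrimrecPred.exists_lt_of {n : α → ℕ} {R : α → ℕ → Prop} (hn : Primrec n)
    (hR : PrimrecPred fun q : α × ℕ => R q.1 q.2) : PrimrecPred fun a => ∃ x < n a, R a x := by
  have h : PrimrecRel fun (x : ℕ) (a : α) => R a x :=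
    hR.comp (Primrec.pair Primrec.snd Primrec.fst)
  exact (h.exists_mem_list.comp (Primrec.list_range.comp hn) Primrec.id).of_eq (by simp)

theorem _root_.Primrec.nat_pow : Primrec₂ ((· ^ ·) : ℕ → ℕ → ℕ) :=
  Primrec₂.unpaired'.1 Nat.Primrec.pow

theorem _root_.PrimrecPred.testBit {P x : α → ℕ} (hP : Primrec P) (hx : Primrec x) :
    PrimrecPred fun a => (P a).testBit (x a) = true :=
  (Primrec.eq.comp (Primrec.nat_mod.comp (Primrec.nat_div.comp hP
    (Primrec.nat_pow.comp (Primrec.const 2) hx)) (Primrec.const 2)) (Primrec.const 1)).of_eq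
    fun a => by simp [Nat.testBit_eq_decide_div_mod_eq]

theorem primrec_equivTuple : Primrec equivTuple := Primrec.of_equiv

theorem primrec_size (hc : Primrec c) : Primrec fun a => (c a).size :=
  Primrec.fst.comp (primrec_equivTuple.comp hc)

theorem primrec_one (hc : Primrec c) : Primrec fun a => (c a).one :=
  Primrec.fst.comp (Primrec.snd.comp (primrec_equivTuple.comp hc))

theorem primrec_mul (hc : Primrec c) : Primrec fun a => (c a).mul :=
  Primrec.fst.comp (Primrec.snd.comp (Primrec.snd.comp (primrec_equivTuple.comp hc)))

theorem primrec_sharp (hc : Primrec c) : Primrec fun a => (c a).sharp :=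
  Primrec.fst.comp (Primrec.snd.comp (Primrec.snd.comp
    (Primrec.snd.comp (primrec_equivTuple.comp hc))))

theorem primrec_le (hc : Primrec c) : Primrec fun a => (c a).le :=
  Primrec.fst.comp (Primrec.snd.comp (Primrec.snd.comp
    (Primrec.snd.comp (Primrec.snd.comp (primrec_equivTuple.comp hc)))))

theorem primrec_letters (hc : Primrec c) : Primrec fun a => (c a).letters :=
  Primrec.fst.comp (Primrec.snd.comp (Primrec.snd.comp (Primrec.snd.comp
    (Primrec.snd.comp (Primrec.snd.comp (primrec_equivTuple.comp hc))))))

theorem primrec_ideal (hc : Primrec c) : Primrec fun a => (c a).ideal :=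
  Primrec.snd.comp (Primrec.snd.comp (Primrec.snd.comp (Primrec.snd.comp
    (Primrec.snd.comp (Primrec.snd.comp (primrec_equivTuple.comp hc))))))

variable {i j : α → ℕ}

theorem primrec_mulAt (hc : Primrec c) (hi : Primrec i) (hj : Primrec j) :
    Primrec fun a => (c a).mulAt (i a) (j a) :=
  (Primrec.list_getD 0).comp ((Primrec.list_getD []).comp (primrec_mul hc) hi) hj

theorem primrecPred_leAt (hc : Primrec c) (hi : Primrec i) (hj : Primrec j) :
    PrimrecPred fun a => (c a).leAt (i a) (j a) = true :=
  Primrec.eq.comp ((Primrec.list_getD false).comp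
    ((Primrec.list_getD []).comp (primrec_le hc) hi) hj) (Primrec.const true)

theorem primrec_sharpAt (hc : Primrec c) (hi : Primrec i) :
    Primrec fun a => (c a).sharpAt (i a) :=
  (Primrec.list_getD 0).comp (primrec_sharp hc) hi

theorem primrecPred_isLowerMask (hc : Primrec c) (hi : Primrec i) :
    PrimrecPred fun a => (c a).IsLowerMask (i a) := by
  have h1 : Primrec fun q : (α × ℕ) × ℕ => q.1.1 := Primrec.fst.comp Primrec.fst
  have hx : Primrec fun q : (α × ℕ) × ℕ => q.1.2 := Primrec.snd.comp Primrec.fst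
  have hy : Primrec fun q : (α × ℕ) × ℕ => q.2 := Primrec.snd
  exact .forall_lt_of (primrec_size hc) (.forall_lt_of (primrec_size (hc.comp Primrec.fst))
    ((primrecPred_leAt (hc.comp h1) hx hy).imp
      ((PrimrecPred.testBit (hi.comp h1) hy).imp (PrimrecPred.testBit (hi.comp h1) hx))))

theorem primrec_lowers (hc : Primrec c) : Primrec fun a => (c a).lowers := by
  classical
  have h : PrimrecRel fun (P : ℕ) (c : StabCode) => c.IsLowerMask P :=
    primrecPred_isLowerMask Primrec.snd Primrec.fst
  exact (h.listFilter.comp (Primrec.list_range.comp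
    (Primrec.nat_pow.comp (Primrec.const 2) (primrec_size hc))) hc).of_eq
    fun a => by simp [lowers]

theorem primrec_index (hc : Primrec c) {φ : α → ℕ → Prop}
    (hφ : PrimrecPred fun q : α × ℕ => φ q.1 q.2) : Primrec fun a => (c a).index (φ a) := by
  classical
  have h1 : Primrec fun q : (α × ℕ) × ℕ => q.1.1 := Primrec.fst.comp Primrec.fst
  have hR : Primrec fun q : (α × ℕ) × ℕ => q.1.2 := Primrec.snd.comp Primrec.fst
  have h : PrimrecRel fun (a : α) (R : ℕ) =>
      ∀ x < (c a).size, (R.testBit x = true ↔ φ a x) :=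
    PrimrecPred.forall_lt_of (primrec_size (hc.comp Primrec.fst))
      ((PrimrecPred.testBit hR Primrec.snd).iff (hφ.comp (h1.pair Primrec.snd)))
  refine (Primrec.list_findIdx (primrec_lowers hc) h.decide).of_eq fun a => ?_
  simp only [index]

theorem primrecPred_memMul {P Q x : α → ℕ} (hc : Primrec c) (hP : Primrec P) (hQ : Primrec Q)
    (hx : Primrec x) : PrimrecPred fun a => (c a).MemMul (P a) (Q a) (x a) := by
  have h1 : Primrec fun q : (α × ℕ) × ℕ => q.1.1 := Primrec.fst.comp Primrec.fst
  have hp : Primrec fun q : (α × ℕ) × ℕ => q.1.2 := Primrec.snd.comp Primrec.fst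
  have hq : Primrec fun q : (α × ℕ) × ℕ => q.2 := Primrec.snd
  exact .exists_lt_of (primrec_size hc) (.exists_lt_of (primrec_size (hc.comp Primrec.fst))
    ((PrimrecPred.testBit (hP.comp h1) hp).and ((PrimrecPred.testBit (hQ.comp h1) hq).and
      (primrecPred_leAt (hc.comp h1) (hx.comp h1) (primrec_mulAt (hc.comp h1) hp hq)))))

theorem primrecPred_memSharp {E x : α → ℕ} (hc : Primrec c) (hE : Primrec E)
    (hx : Primrec x) : PrimrecPred fun a => (c a).MemSharp (E a) (x a) := by
  have h1 : Primrec fun q : ((α × ℕ) × ℕ) × ℕ => q.1.1.1 :=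
    Primrec.fst.comp (Primrec.fst.comp Primrec.fst)
  have ha : Primrec fun q : ((α × ℕ) × ℕ) × ℕ => q.1.1.2 :=
    Primrec.snd.comp (Primrec.fst.comp Primrec.fst)
  have he : Primrec fun q : ((α × ℕ) × ℕ) × ℕ => q.1.2 := Primrec.snd.comp Primrec.fst
  have hb : Primrec fun q : ((α × ℕ) × ℕ) × ℕ => q.2 := Primrec.snd
  have hc' := hc.comp h1
  exact .exists_lt_of (primrec_size hc) (.exists_lt_of (primrec_size (hc.comp Primrec.fst))
    (.exists_lt_of (primrec_size (hc.comp (Primrec.fst.comp Primrec.fst)))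
      ((PrimrecPred.testBit (hE.comp h1) ha).and ((PrimrecPred.testBit (hE.comp h1) he).and
        ((PrimrecPred.testBit (hE.comp h1) hb).and
          ((Primrec.eq.comp (primrec_mulAt hc' he he) he).and
            (primrecPred_leAt hc' (hx.comp h1) (primrec_mulAt hc'
              (primrec_mulAt hc' ha (primrec_sharpAt hc' he)) hb))))))))

theorem primrecPred_memLetter {z : α → List ℕ} {b x : α → ℕ} (hc : Primrec c) (hz : Primrec z)
    (hb : Primrec b) (hx : Primrec x) :
    PrimrecPred fun a => (c a).MemLetter (z a) (b a) (x a) :=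
  .exists_lt_of (Primrec.list_length.comp hz)
    ((Primrec.eq.comp ((Primrec.list_getD 0).comp (hz.comp Primrec.fst) Primrec.snd)
      (hb.comp Primrec.fst)).and (primrecPred_leAt (hc.comp Primrec.fst) (hx.comp Primrec.fst)
        ((Primrec.list_getD 0).comp (primrec_letters (hc.comp Primrec.fst)) Primrec.snd)))

/-- Everything is assembled from table lookups, bit tests and quantifiers bounded by the size of the
monoid or the alphabet, so the construction is even primitive recursive. -/
theorem primrec_idealsCode : Primrec idealsCode := by
  classical
  have hc : Primrec fun t : StabCode × ℕ × List ℕ => t.1 := Primrec.fst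
  have hL := primrec_lowers hc
  have h1 : Primrec fun q : ((StabCode × ℕ × List ℕ) × ℕ) × ℕ => q.1.1 :=
    Primrec.fst.comp Primrec.fst
  have hP : Primrec fun q : ((StabCode × ℕ × List ℕ) × ℕ) × ℕ => q.1.2 :=
    Primrec.snd.comp Primrec.fst
  have hone : Primrec fun t : StabCode × ℕ × List ℕ =>
      t.1.index fun x => t.1.leAt x t.1.one = true :=
    primrec_index hc (primrecPred_leAt (hc.comp Primrec.fst) Primrec.snd
      (primrec_one (hc.comp Primrec.fst)))
  have hmul : Primrec fun t : StabCode × ℕ × List ℕ =>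
      t.1.lowers.map fun P => t.1.lowers.map fun Q => t.1.index (t.1.MemMul P Q) :=
    Primrec.list_map hL (Primrec.list_map (hL.comp Primrec.fst)
      (primrec_index (hc.comp h1) (primrecPred_memMul (hc.comp (h1.comp Primrec.fst))
        (hP.comp Primrec.fst) (Primrec.snd.comp Primrec.fst) Primrec.snd)))
  have hsharp : Primrec fun t : StabCode × ℕ × List ℕ =>
      t.1.lowers.map fun E => t.1.index (t.1.MemSharp E) :=
    Primrec.list_map hL (primrec_index (hc.comp Primrec.fst)
      (primrecPred_memSharp (hc.comp h1) hP Primrec.snd))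
  have hle : Primrec fun t : StabCode × ℕ × List ℕ =>
      t.1.lowers.map fun P => t.1.lowers.map fun Q =>
        decide (∀ x < t.1.size, P.testBit x = true → Q.testBit x = true) := by
    refine Primrec.list_map hL (Primrec.list_map (hL.comp Primrec.fst) ?_)
    exact (PrimrecPred.forall_lt_of (primrec_size (hc.comp h1))
      ((PrimrecPred.testBit (hP.comp Primrec.fst) Primrec.snd).imp
        (PrimrecPred.testBit (Primrec.snd.comp Primrec.fst) Primrec.snd))).decide
  have hletters : Primrec fun t : StabCode × ℕ × List ℕ =>
      (List.range t.2.1).map fun b => t.1.index (t.1.MemLetter t.2.2 b) :=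
    Primrec.list_map (Primrec.list_range.comp (Primrec.fst.comp Primrec.snd))
      (primrec_index (hc.comp Primrec.fst) (primrecPred_memLetter (hc.comp h1)
        (Primrec.snd.comp (Primrec.snd.comp h1)) hP Primrec.snd))
  have hideal : Primrec fun t : StabCode × ℕ × List ℕ => t.1.lowers.map fun P =>
      decide (∀ x < t.1.size, P.testBit x = true → t.1.ideal.getD x false = true) := by
    refine Primrec.list_map hL ?_
    exact (PrimrecPred.forall_lt_of (primrec_size (hc.comp Primrec.fst))
      ((PrimrecPred.testBit hP Primrec.snd).imp
        (Primrec.eq.comp ((Primrec.list_getD false).comp (primrec_ideal (hc.comp h1))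
          Primrec.snd) (Primrec.const true)))).decide
  have htuple := (Primrec.list_length.comp hL).pair (hone.pair (hmul.pair (hsharp.pair
    (hle.pair (hletters.pair hideal)))))
  refine ((Primrec.of_equiv_symm (e := equivTuple)).comp htuple).of_eq fun t => ?_
  simp only [idealsCode, equivTuple, Equiv.coe_fn_symm_mk]

end Computability

end StabCode

/-! ### Correctness of the table -/

theorem List.map_eq_ofFn_getElem {α : Type u} {β : Type v} (l : List α) (f : α → β) :
    l.map f = List.ofFn fun i : Fin l.length => f l[i] := by
  apply List.ext_getElem <;> simp

theorem List.getD_ofFn {α : Type u} {n : ℕ} (f : Fin n → α) (d : α) (i : Fin n) :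
    (List.ofFn f).getD (i : ℕ) d = f i := by
  simp [List.getD_eq_getElem?_getD]

namespace StabCode

theorem mem_lowers {c : StabCode} {P : ℕ} :
    P ∈ c.lowers ↔ P < 2 ^ c.size ∧ c.IsLowerMask P := by
  simp [lowers]

theorem nodup_lowers (c : StabCode) : c.lowers.Nodup := List.nodup_range.filter _

/-- Uniqueness determines the value of `index`. -/
theorem index_eq {c : StabCode} {φ : ℕ → Prop} {i : ℕ} (hi : i < c.lowers.length)
    (h : ∀ j (hj : j < c.lowers.length),
      (∀ x < c.size, (c.lowers[j].testBit x = true ↔ φ x)) ↔ j = i) : c.index φ = i := by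
  classical
  rw [index, List.findIdx_eq hi]
  refine ⟨by simpa using (h i hi).2 rfl, fun j hj => ?_⟩
  have hjl := hj.trans hi
  have : ¬ ∀ x < c.size, (c.lowers[j].testBit x = true ↔ φ x) :=
    fun h' => hj.ne ((h j hjl).1 h')
  simpa using this

section

variable {M : Type u} {c : StabCode} (e : M ≃ Fin c.size)

theorem forall_lt_size_iff {p : ℕ → Prop} : (∀ x < c.size, p x) ↔ ∀ a : M, p (e a) :=
  ⟨fun h a => h _ (e a).2, fun h x hx => by simpa using h (e.symm ⟨x, hx⟩)⟩

theorem exists_lt_size_iff {p : ℕ → Prop} : (∃ x < c.size, p x) ↔ ∃ a : M, p (e a) :=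
  ⟨fun ⟨x, hx, h⟩ => ⟨e.symm ⟨x, hx⟩, by simpa using h⟩, fun ⟨a, h⟩ => ⟨_, (e a).2, h⟩⟩

variable [PartialOrder M] (hle : ∀ a b, c.leAt (e a) (e b) = true ↔ a ≤ b)
include hle

theorem isLowerMask_iff {P : ℕ} :
    c.IsLowerMask P ↔ IsLowerSet {a : M | P.testBit (e a) = true} := by
  rw [IsLowerMask, forall_lt_size_iff e]
  simp only [forall_lt_size_iff e, hle]
  exact ⟨fun h a b hba ha => h b a hba ha, fun h a b hab hb => h hab hb⟩

/-- The numbering of the ideals. -/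
theorem exists_equiv_lowers : ∃ e' : LowerSet M ≃ Fin c.lowers.length,
    ∀ i a, a ∈ e'.symm i ↔ c.lowers[i].testBit (e a) = true := by
  let g : Fin c.lowers.length → LowerSet M := fun i =>
    ⟨{a | c.lowers[i].testBit (e a) = true},
      (isLowerMask_iff e hle).1 (mem_lowers.1 (List.getElem_mem i.2)).2⟩
  have hg : ∀ i a, a ∈ g i ↔ c.lowers[i].testBit (e a) = true := fun i a => Iff.rfl
  have hinj : Function.Injective g := by
    intro i j hij
    have hlt : ∀ i : Fin c.lowers.length, c.lowers[i] < 2 ^ c.size := fun i =>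
      (mem_lowers.1 (List.getElem_mem i.2)).1
    have : c.lowers[i] = c.lowers[j] := by
      refine Nat.eq_of_testBit_eq fun x => ?_
      rcases Nat.lt_or_ge x c.size with hx | hx
      · have := hg i (e.symm ⟨x, hx⟩)
        rw [hij, hg j] at this
        simp only [Equiv.apply_symm_apply] at this
        exact (Bool.eq_iff_iff.2 this).symm
      -- Masks below `2 ^ c.size` have no bits beyond the elements of the monoid, so each ideal has
      -- exactly one mask.
      · have hpow : 2 ^ c.size ≤ 2 ^ x := Nat.pow_le_pow_right (by omega) hx
        rw [Nat.testBit_lt_two_pow ((hlt i).trans_le hpow),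
          Nat.testBit_lt_two_pow ((hlt j).trans_le hpow)]
    exact Fin.ext ((c.nodup_lowers.getElem_inj_iff).1 this)
  have hsurj : Function.Surjective g := by
    classical
    intro Q
    let P := Nat.ofBits fun x : Fin c.size => decide (e.symm x ∈ Q)
    have hP : ∀ a, P.testBit (e a) = true ↔ a ∈ Q := fun a => by
      rw [Nat.testBit_ofBits_lt _ _ (e a).2]
      simp
    have hmem : P ∈ c.lowers := mem_lowers.2 ⟨Nat.ofBits_lt_two_pow _,
      (isLowerMask_iff e hle).2 fun a b hba ha => (hP b).2 (Q.lower hba ((hP a).1 ha))⟩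
    obtain ⟨i, hi, hiP⟩ := List.mem_iff_getElem.1 hmem
    refine ⟨⟨i, hi⟩, ?_⟩
    ext a
    change a ∈ g ⟨i, hi⟩ ↔ a ∈ Q
    rw [hg, ← hP]
    simp [hiP]
  refine ⟨(Equiv.ofBijective g ⟨hinj, hsurj⟩).symm, fun i a => ?_⟩
  exact hg i a

omit hle in
theorem index_eq_of_equiv {e' : LowerSet M ≃ Fin c.lowers.length}
    (he' : ∀ i a, a ∈ e'.symm i ↔ c.lowers[i].testBit (e a) = true) {φ : ℕ → Prop}
    {Q : LowerSet M} (hφ : ∀ a, φ (e a) ↔ a ∈ Q) : c.index φ = (e' Q : ℕ) := by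
  refine index_eq (e' Q).2 fun j hj => ?_
  rw [forall_lt_size_iff e]
  have h : ∀ a, c.lowers[j].testBit (e a) = true ↔ a ∈ e'.symm ⟨j, hj⟩ :=
    fun a => (he' ⟨j, hj⟩ a).symm
  simp only [h, hφ]
  constructor
  · intro h'
    have : e'.symm ⟨j, hj⟩ = Q := by
      ext a
      exact h' a
    rw [← this]
    simp
  · rintro rfl
    simp

end

/-- The numbering sends an ideal to the position of its mask. The stabilisation entries are checked
at idempotent ideals only, where `mem_ideals_sharp` turns strict expressions into the search over
triples in `MemSharp`. -/
theorem Presents.idealsCode {M : Type u} [PartialOrder M] {S : StabStructure M}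
    (hS : S.IsStabilisationMonoid) {k l : ℕ} {h : Fin k → M} {I : LowerSet M}
    {z : Fin k → Fin l} {c : StabCode} (hc : c.Presents S h I) :
    (idealsCode (c, l, List.ofFn fun i => (z i : ℕ))).Presents S.ideals (idealMap h z)
      (LowerSet.Iic I) := by
  classical
  obtain ⟨e, hone, hmul, hlen, hsharp, hle, hletters, hideal⟩ := hc
  have hleAt : ∀ a b, c.leAt (e a) (e b) = true ↔ a ≤ b := fun a b => by
    simp only [leAt, hle, List.getD_ofFn]
    simp
  have hmulAt : ∀ a b, c.mulAt (e a) (e b) = (e (S.mul a b) : ℕ) := fun a b => by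
    simp only [mulAt, hmul, List.getD_ofFn]
    simp
  have hsharpAt : ∀ a, S.Idem a → c.sharpAt (e a) = (e (S.sharp a) : ℕ) := fun a ha => by
    rw [sharpAt, List.getD_eq_getElem?_getD, hsharp a ha]
    rfl
  have hmem : ∀ a, c.ideal.getD (e a) false = true ↔ a ∈ I := fun a => by
    simp only [hideal, List.getD_ofFn]
    simp
  have hlet : ∀ i : Fin k, c.letters.getD (i : ℕ) 0 = (e (h i) : ℕ) := fun i => by
    simp only [hletters, List.getD_ofFn]
  obtain ⟨e', he'⟩ := exists_equiv_lowers e hleAt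
  have hidem : ∀ a, c.mulAt (e a) (e a) = e a ↔ S.Idem a := fun a => by
    rw [hmulAt, Fin.val_inj, e.injective.eq_iff]
    rfl
  refine ⟨e', ?_, ?_, ?_, ?_, ?_, ?_, ?_⟩
  · refine index_eq_of_equiv e he' fun a => ?_
    simp only [hone, hleAt]
    exact StabStructure.mem_ideals_one.symm
  · change (c.lowers.map fun P => c.lowers.map fun Q => c.index (c.MemMul P Q)) =
      List.ofFn fun i => List.ofFn fun j => (e' (S.ideals.mul (e'.symm i) (e'.symm j)) : ℕ)
    simp only [List.map_eq_ofFn_getElem]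
    refine congrArg List.ofFn (funext fun i => congrArg List.ofFn (funext fun j => ?_))
    refine index_eq_of_equiv e he' fun a => ?_
    simp only [MemMul, exists_lt_size_iff e, hmulAt, hleAt, StabStructure.mem_ideals_mul, he']
    simp only [exists_and_left]
  · simp [StabCode.idealsCode]
  · intro E hE
    change (c.lowers.map fun E => c.index (c.MemSharp E))[(e' E : ℕ)]? =
      some (e' (S.ideals.sharp E) : ℕ)
    rw [List.getElem?_map, List.getElem?_eq_getElem (e' E).2, Option.map_some]
    congr 1
    refine index_eq_of_equiv e he' fun a => ?_
    rw [hS.mem_ideals_sharp hE]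
    have hE' : ∀ a, c.lowers[e' E].testBit (e a) = true ↔ a ∈ E := fun a => by
      rw [← he', Equiv.symm_apply_apply]
    simp only [MemSharp, exists_lt_size_iff e, hidem]
    constructor
    · rintro ⟨x, f, y, hx, hf, hy, hi, hle⟩
      rw [hsharpAt f hi, hmulAt, hmulAt, hleAt] at hle
      exact ⟨x, (hE' x).1 hx, f, (hE' f).1 hf, y, (hE' y).1 hy, hi, hle⟩
    · rintro ⟨x, hx, f, hf, y, hy, hi, hle⟩
      refine ⟨x, f, y, (hE' x).2 hx, (hE' f).2 hf, (hE' y).2 hy, hi, ?_⟩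
      rwa [hsharpAt f hi, hmulAt, hmulAt, hleAt]
  · change (c.lowers.map fun P => c.lowers.map fun Q =>
      decide (∀ x < c.size, P.testBit x = true → Q.testBit x = true)) =
      List.ofFn fun i => List.ofFn fun j => decide (e'.symm i ≤ e'.symm j)
    simp only [List.map_eq_ofFn_getElem]
    refine congrArg List.ofFn (funext fun i => congrArg List.ofFn (funext fun j => ?_))
    refine decide_eq_decide.2 ?_
    rw [forall_lt_size_iff e]
    change _ ↔ ∀ a, a ∈ e'.symm i → a ∈ e'.symm j
    simp only [he']
  · simp only [StabCode.idealsCode]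
    apply List.ext_getElem (by simp)
    intro b hb hb'
    simp only [List.getElem_map, List.getElem_range, List.getElem_ofFn]
    refine index_eq_of_equiv e he' fun a => ?_
    rw [StabStructure.mem_idealMap]
    simp only [MemLetter, List.length_ofFn]
    constructor
    · rintro ⟨i, hi, hz, hle⟩
      have h1 := List.getD_ofFn (fun i => (z i : ℕ)) 0 ⟨i, hi⟩
      have h2 := hlet ⟨i, hi⟩
      simp only at h1 h2
      rw [h1] at hz
      rw [h2, hleAt] at hle
      exact ⟨⟨i, hi⟩, Fin.ext hz, hle⟩
    · rintro ⟨i, hz, hle⟩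
      refine ⟨i, i.2, ?_, ?_⟩
      · rw [List.getD_ofFn, hz]
      · rwa [hlet, hleAt]
  · change (c.lowers.map fun P =>
      decide (∀ x < c.size, P.testBit x = true → c.ideal.getD x false = true)) =
      List.ofFn fun i => decide (e'.symm i ∈ LowerSet.Iic I)
    simp only [List.map_eq_ofFn_getElem]
    refine congrArg List.ofFn (funext fun i => decide_eq_decide.2 ?_)
    rw [forall_lt_size_iff e]
    change _ ↔ ∀ a, a ∈ e'.symm i → a ∈ I
    simp only [he', hmem]

end StabCode

theorem mainTheorem5 :
    -- the ideals form a stabilisation monoid, which recognises the inf-projections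
    (∀ (M : Type u) [PartialOrder M] (S : StabStructure M), S.IsStabilisationMonoid →
      S.ideals.IsStabilisationMonoid ∧
      ∀ (A : Type v) (B : Type w) (h : A → M) (I : LowerSet M) (z : A → B) (f : List A → ℕ∞),
        S.Recognises h I f →
          S.ideals.Recognises (idealMap h z) (LowerSet.Iic I) (infProjection z f)) ∧
    -- and it can be computed, together with the map of the letters and the ideal
    (∃ F : StabCode × ℕ × List ℕ → StabCode, Computable F ∧
      ∀ (M : Type u) [PartialOrder M] (S : StabStructure M), S.IsStabilisationMonoid →
      ∀ (k l : ℕ) (h : Fin k → M) (I : LowerSet M) (z : Fin k → Fin l) (c : StabCode),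
        c.Presents S h I →
          (F (c, l, List.ofFn fun i => (z i : ℕ))).Presents
            S.ideals (idealMap h z) (LowerSet.Iic I)) :=
  ⟨fun _ _ _ hS => ⟨hS.ideals, fun _ _ _ _ _ _ hf => hS.recognises_infProjection hf⟩,
    StabCode.idealsCode, StabCode.primrec_idealsCode.to_comp,
    fun _ _ _ hS _ _ _ _ _ _ hc => hc.idealsCode hS⟩
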